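/- Consider $f$ asynchronous, crash-prone processes $q_1,\dots,q_f$ that communicate only through a single-writer snapshot object $H$ with $f$ components: a step of $q_i$ is a scan of $H$ (which returns all components) or an update of the $i$'th component of $H$, together with local computation. An $m$-component augmented snapshot object $M$, with components initially $\bot$, has two operations: a Scan, and a Block-Update of a nonempty sequence of pairwise different components $j_1,\dots,j_r$ with values $v_1,\dots,v_r$. A Block-Update is comprised of $r$ atomic Updates, in any order, where the $g$'th sets $M[j_g]$ to $v_g$; it returns either a view (the values of all $m$ components) or the yield symbol, and it is called atomic if it returns a view. The execution interval of an operation extends from its first to its last step, and is infinite if the operation does not complete. For all $f$ and $m$ and every set of values there is a deterministic implementation of $M$ from $H$ with the following properties. 1. Every (finite or infinite) execution has a linearization of the Scans and of the Updates that the Block-Updates are comprised of: each of them has a linearization point within the execution interval of its operation (incomplete operations may be left out, wholly or in part), and each completed Scan returns the view at its linearization point. Moreover, in this linearization, the Updates of each atomic Block-Update are consecutive, and each atomic Block-Update $B$ returns the view at some point $T$ such that $T$ is before the first Update $Z$ of $B$, $T$ is after the last Update prior to $Z$ that is part of an atomic Block-Update (if there is one), and no Scan is linearized between $T$ and $Z$.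 2. The implementation is non-blocking: infinitely many operations are completed in every infinite execution. More precisely, every Block-Update is wait-free (it is completed if its process takes enough steps), and a Scan whose process takes infinitely many steps can fail to complete only if infinitely many Block-Updates are completed. 3. A Block-Update by $q_i$ returns the yield symbol only if its execution interval contains an update of $H$ by some $q_j$ with $j<i$, performed as part of a Block-Update by $q_j$; moreover, this update is the first update of $H$ in that Block-Update by $q_j$. -/

import Mathlib

universe u

namespace AugSnapshot

/-! ### The interface of the augmented snapshot object -/

/-- A view: the value of each of the `m` components; `none` is the initial value `⊥`. -/
abbrev View (m : ℕ) (V : Type u) : Type u := Fin m → Option V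

/-- The argument of a Block-Update: a nonempty sequence of pairs (component, value) whose
components are pairwise different. -/
structure BlockArg (m : ℕ) (V : Type u) : Type u where
  pairs : List (Fin m × V)
  nonempty : pairs ≠ []
  distinct : (pairs.map Prod.fst).Nodup

/-- The operations of an `m`-component augmented snapshot object. -/
inductive Op (m : ℕ) (V : Type u) : Type u where
  | scan : Op m V
  | blockUpdate (a : BlockArg m V) : Op m V

/-- The responses: a view, or the yield symbol. -/
inductive Response (m : ℕ) (V : Type u) : Type u where
  | view (w : View m V) : Response m V
  | yield : Response m V

/-! ### Implementations from a single-writer snapshot, and their executions -/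

/-- The step that a process is about to take: one operation on the single-writer snapshot `H`
(a scan of all components, or an update of the process's own component), followed by local
computation, which leads either to a new local state, or to the response of the operation on the
augmented snapshot that the process is carrying out. -/
inductive Action (f m : ℕ) (V Reg Loc : Type u) : Type u where
  | scan (k : (Fin f → Reg) → Loc ⊕ Response m V) : Action f m V Reg Loc
  | update (x : Reg) (k : Loc ⊕ Response m V) : Action f m V Reg Loc

/-- An implementation, for `f` processes, of the operations of the augmented snapshot from a
single-writer snapshot `H` with one component per process: for each process and each operation a
deterministic procedure, given by its starting state and by the step taken in each local state. -/
structure Implementation (f m : ℕ) (V : Type u) : Type (u + 1) where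
  /-- possible values of a component of `H` -/
  Reg : Type u
  /-- initial value of every component of `H` -/
  init : Reg
  /-- local states of a process that is carrying out an operation -/
  Loc : Type u
  start : Fin f → Op m V → Loc
  code : Fin f → Loc → Action f m V Reg Loc

variable {f m : ℕ} {V : Type u}

namespace Implementation

/-- A configuration: the value of `H`, and the local state of each process (`none` if the process
has no pending operation). -/
structure Config (I : Implementation f m V) : Type u where
  reg : Fin f → I.Reg
  loc : Fin f → Option I.Loc

/-- The initial configuration. -/
def initial (I : Implementation f m V) : I.Config where
  reg := fun _ => I.init
  loc := fun _ => none

/-- The step that process `i` takes in configuration `C`. If it has no pending operation, then it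
is the first step of a new operation `o`; otherwise `o` is irrelevant. -/
def action (I : Implementation f m V) (C : I.Config) (i : Fin f) (o : Op m V) :
    Action f m V I.Reg I.Loc :=
  I.code i ((C.loc i).getD (I.start i o))

/-- The outcome of that step for process `i`: a new local state or a response. -/
def outcome (I : Implementation f m V) (C : I.Config) (i : Fin f) (o : Op m V) :
    I.Loc ⊕ Response m V :=
  match I.action C i o with
  | .scan k => k C.reg
  | .update _ k => k

/-- The value of `H` after that step. -/
def regAfter (I : Implementation f m V) (C : I.Config) (i : Fin f) (o : Op m V) :
    Fin f → I.Reg :=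
  match I.action C i o with
  | .scan _ => C.reg
  | .update x _ => Function.update C.reg i x

/-- The configuration after that step. -/
def stepConfig (I : Implementation f m V) (C : I.Config) (i : Fin f) (o : Op m V) : I.Config where
  reg := I.regAfter C i o
  loc := Function.update C.loc i ((I.outcome C i o).getLeft?)

end Implementation

/-- A schedule determines an execution. `σ t = some (i, o)` means that process `i` takes the step
at time `t`, and that the operation it begins there is `o` in case it has no pending operation.
`σ t = none` means that no step is taken at time `t`; so the finite executions are given by the
schedules that are eventually `none`, the infinite ones by those that are infinitely often
different from `none`. -/
abbrev Schedule (f m : ℕ) (V : Type u) : Type u := ℕ → Option (Fin f × Op m V)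

namespace Implementation

variable (I : Implementation f m V) (σ : Schedule f m V)

/-- The configuration just before time `t`. -/
def conf : ℕ → I.Config
  | 0 => I.initial
  | t + 1 =>
    match σ t with
    | none => conf t
    | some (i, o) => I.stepConfig (conf t) i o

/-- Process `i` begins the operation `o` with its step at time `s`. An operation instance is
identified by the time of its first step. -/
def Begins (s : ℕ) (i : Fin f) (o : Op m V) : Prop :=
  σ s = some (i, o) ∧ (I.conf σ s).loc i = none

/-- The step at time `t` is by process `i` and gives its pending operation the response `r`. -/
def Responds (t : ℕ) (i : Fin f) (r : Response m V) : Prop :=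
  ∃ o, σ t = some (i, o) ∧ I.outcome (I.conf σ t) i o = Sum.inr r

/-- The operation `o` that process `i` begins at time `s` is completed, with last step at time `e`
and response `r`. -/
def Completes (i : Fin f) (o : Op m V) (s e : ℕ) (r : Response m V) : Prop :=
  I.Begins σ s i o ∧ s ≤ e ∧ I.Responds σ e i r ∧
    ∀ t, s ≤ t → t < e → ∀ r', ¬ I.Responds σ t i r'

/-- Time `t` lies in the execution interval of the operation `o` that process `i` begins at
time `s`: from its first step on, and up to its last step if the operation is completed. -/
def InInterval (i : Fin f) (o : Op m V) (s t : ℕ) : Prop :=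
  I.Begins σ s i o ∧ s ≤ t ∧ ∀ e r, I.Completes σ i o s e r → t ≤ e

/-- The step at time `t` is an update of `H` by process `i`, performed as part of the operation `o`
that `i` begins at time `s`. -/
def UpdateIn (i : Fin f) (o : Op m V) (s t : ℕ) : Prop :=
  I.InInterval σ i o s t ∧
    ∃ o' x k, σ t = some (i, o') ∧ I.action (I.conf σ t) i o' = Action.update x k

/-- The same, and the step is the first such update in that operation. -/
def FirstUpdateIn (i : Fin f) (o : Op m V) (s t : ℕ) : Prop :=
  I.UpdateIn σ i o s t ∧ ∀ t', I.UpdateIn σ i o s t' → t ≤ t'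

/-- The operation begun at time `s` is a Block-Update that is atomic, that is, it returns a view
and not the yield symbol. -/
def Atomic (s : ℕ) : Prop :=
  ∃ i a e w, I.Completes σ i (Op.blockUpdate a) s e (Response.view w)

/-! ### Linearizations -/

end Implementation

/-- The atomic events that are linearized: the Scan begun at time `s`, or the Update of component
`j` to `v` that is part of the Block-Update begun at time `s`. -/
inductive Event (m : ℕ) (V : Type u) : Type u where
  | scan (s : ℕ) : Event m V
  | update (s : ℕ) (j : Fin m) (v : V) : Event m V

/-- The effect of an event on the contents of the augmented snapshot. -/
def Event.apply : Event m V → View m V → View m V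
  | .scan _, w => w
  | .update _ j v, w => Function.update w j (some v)

/-- A finite or infinite sequence of events (positions may be left empty), together with the time
at which each position is placed. -/
structure EventSeq (m : ℕ) (V : Type u) : Type u where
  event : ℕ → Option (Event m V)
  time : ℕ → ℕ

/-- The contents of the augmented snapshot just before position `p`. -/
def EventSeq.contents (S : EventSeq m V) : ℕ → View m V
  | 0 => fun _ => none
  | p + 1 =>
    match S.event p with
    | none => contents S p
    | some x => x.apply (contents S p)

namespace Implementation

variable (I : Implementation f m V) (σ : Schedule f m V)

/-- `S` is a linearization of the Scans, and of the Updates that the Block-Updates are comprised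
of: every event in `S` occurs once and has its linearization point in the execution interval of
its operation, the order agrees with the order of the linearization points, all events of
completed operations occur (incomplete operations may contribute events or not), and each
completed Scan returns the contents at its linearization point. -/
structure IsLinearization (S : EventSeq m V) : Prop where
  mono : Monotone S.time
  once : ∀ p q x, S.event p = some x → S.event q = some x → p = q
  scan_mem : ∀ p s, S.event p = some (Event.scan s) →
    ∃ i, I.InInterval σ i Op.scan s (S.time p)
  update_mem : ∀ p s j v, S.event p = some (Event.update s j v) →
    ∃ i a, (j, v) ∈ a.pairs ∧ I.InInterval σ i (Op.blockUpdate a) s (S.time p)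
  scan_complete : ∀ i s e r, I.Completes σ i Op.scan s e r →
    ∃ p, S.event p = some (Event.scan s) ∧ r = Response.view (S.contents p)
  update_complete : ∀ i a s e r, I.Completes σ i (Op.blockUpdate a) s e r →
    ∀ j v, (j, v) ∈ a.pairs → ∃ p, S.event p = some (Event.update s j v)

/-- The Updates of each atomic Block-Update are consecutive in `S`. -/
def AtomicConsecutive (S : EventSeq m V) : Prop :=
  ∀ s, I.Atomic σ s → ∀ p q p' j v j' v',
    S.event p = some (Event.update s j v) → S.event p' = some (Event.update s j' v') →
    p ≤ q → q ≤ p' → ∀ x, S.event q = some x → ∃ j'' v'', x = Event.update s j'' v''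

/-- Each atomic Block-Update `B` returns the contents at a point `T` of `S` that is not after the
first Update `Z` of `B` and is such that between `T` and `Z` there is no Scan and no Update of an
atomic Block-Update (that is, `T` is after the last Update prior to `Z` that is part of an atomic
Block-Update, if there is one). -/
def AtomicReturnsEarlierView (S : EventSeq m V) : Prop :=
  ∀ i a s e w, I.Completes σ i (Op.blockUpdate a) s e (Response.view w) →
    ∃ T Z, T ≤ Z ∧
      (∃ j v, S.event Z = some (Event.update s j v)) ∧
      (∀ p j v, S.event p = some (Event.update s j v) → Z ≤ p) ∧
      w = S.contents T ∧
      ∀ p, T ≤ p → p < Z →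
        (∀ s', S.event p ≠ some (Event.scan s')) ∧
        (∀ s' j v, S.event p = some (Event.update s' j v) → ¬ I.Atomic σ s')

/-- The implementation satisfies the specification of the augmented snapshot object: every
execution has a linearization with the properties required of atomic Block-Updates. -/
def IsAugmentedSnapshot : Prop :=
  ∀ σ : Schedule f m V, ∃ S : EventSeq m V,
    I.IsLinearization σ S ∧ I.AtomicConsecutive σ S ∧ I.AtomicReturnsEarlierView σ S

/-! ### Progress -/

/-- Infinitely many operations are completed in every infinite execution. -/
def NonBlocking : Prop :=
  ∀ σ : Schedule f m V, {t | σ t ≠ none}.Infinite → {t | ∃ i r, I.Responds σ t i r}.Infinite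

/-- Process `i` takes infinitely many steps in `σ`, but never completes the operation `o` that it
begins at time `s`. -/
def Blocked (i : Fin f) (o : Op m V) (s : ℕ) : Prop :=
  I.Begins σ s i o ∧ {t | ∃ o', σ t = some (i, o')}.Infinite ∧ ∀ e r, ¬ I.Completes σ i o s e r

/-- Block-Updates are wait-free. -/
def BlockUpdateWaitFree : Prop :=
  ∀ (σ : Schedule f m V) i a s, ¬ I.Blocked σ i (Op.blockUpdate a) s

/-- A Scan can only be blocked by infinitely many (completed) Block-Updates. -/
def ScanBlockedOnlyByBlockUpdates : Prop :=
  ∀ (σ : Schedule f m V) i s, I.Blocked σ i Op.scan s →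
    {s' | ∃ j a e r, I.Completes σ j (Op.blockUpdate a) s' e r}.Infinite

/-- A Block-Update by process `i` returns the yield symbol only if its execution interval contains
an update of `H` by a process `j < i`, performed as part of a Block-Update by `j`, and in fact as
the first update of `H` in that Block-Update. -/
def YieldsOnlyToLower : Prop :=
  ∀ (σ : Schedule f m V) i a s e,
    I.Completes σ i (Op.blockUpdate a) s e Response.yield →
    ∃ j < i, ∃ b s' t, I.FirstUpdateIn σ j (Op.blockUpdate b) s' t ∧ s ≤ t ∧ t ≤ e

end Implementation

end AugSnapshot

/-!
The value of `H` holds, for each process, an append-only list of *blocks*, one for each of its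
Block-Updates, together with a log of what the process has seen; the lists of blocks of all
processes form the *history*. A block carries a timestamp: the vector of the numbers of blocks that
its process saw when it began the Block-Update, plus one in its own entry. Timestamps are compared
lexicographically, and a history determines a view in which each component has the value given to
it by the block with the largest timestamp (`History.toView`).

Linearization. An Update is linearized when it becomes covered, that is, when the first block is
appended that has the same component and a timestamp at least as large (`batch`). This is when its
own block is appended, or an earlier step, and then an Update of the same component that is
linearized at that step overwrites it. So the contents of the linearized object are always the view
of the history (`contentsAt_batch`). The point lies in the execution interval, since the timestamp
is larger than all those present when the operation begins (`exists_update_mem_batch`). A Scan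
returns when two scans of `H` find the same history, and is linearized at the second one.

Atomicity. A Block-Update of process `k` yields if some process below `k` has appended a block since
its first step. If it does not yield, then the entries of its timestamp below `k` are still accurate
when its block is appended, so that this timestamp is then the largest one
(`uncovered_of_completes_view`), and its Updates are all linearized at that step, after those that
it overtakes. The view to be returned is found by helping: Scans, and Block-Updates after they have
appended their block, announce the history they see before they scan `H` for the last time. Process
`k` takes the largest among the history it saw at its first step and the announced histories with
as many blocks of `k` as that one, which are those seen before `k` appended its block. Let `T` be
the last time with the history taken. If a Scan were completed, or the block of another atomic
Block-Update appended, between `T` and the step at which `k` appends its block, then the history of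
a later time than `T` would have been announced before `k` scans `H` for the last time, and would be
one of those that `k` chooses from; for a process above `k` this uses that it does not itself yield
to `k` (`exists_latest_time`).

Progress. A Block-Update takes five steps. A Scan is only delayed by appended blocks; if there are
infinitely many, then some process appends infinitely many and thus completes infinitely many
Block-Updates.
-/

namespace AugSnapshot

variable {f m : ℕ} {V : Type u}

/-! ### Operation instances in the executions of an arbitrary implementation -/

namespace Implementation

variable (I : Implementation f m V) (σ : Schedule f m V)

/-- The time at which process `k` took the first step of its most recent operation before
time `t` (junk value `0` if there is none). -/
noncomputable def opStart : ℕ → Fin f → ℕ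
  | 0, _ => 0
  | t + 1, k =>
    open Classical in
    if (∃ o, σ t = some (k, o)) ∧ (I.conf σ t).loc k = none then t else opStart t k

variable {I σ}

theorem conf_succ_of_none {t : ℕ} (h : σ t = none) : I.conf σ (t + 1) = I.conf σ t := by
  simp [conf, h]

theorem conf_succ_of_some {t : ℕ} {k : Fin f} {o : Op m V} (h : σ t = some (k, o)) :
    I.conf σ (t + 1) = I.stepConfig (I.conf σ t) k o := by
  simp [conf, h]

theorem loc_succ_of_ne {t : ℕ} {k : Fin f} (h : ∀ o, σ t ≠ some (k, o)) :
    (I.conf σ (t + 1)).loc k = (I.conf σ t).loc k := by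
  rcases hσ : σ t with _ | ⟨i, o⟩
  · rw [conf_succ_of_none hσ]
  · have hk : k ≠ i := by
      rintro rfl
      exact h o hσ
    rw [conf_succ_of_some hσ]
    simp [stepConfig, hk]

theorem reg_succ_of_ne {t : ℕ} {k : Fin f} (h : ∀ o, σ t ≠ some (k, o)) :
    (I.conf σ (t + 1)).reg k = (I.conf σ t).reg k := by
  rcases hσ : σ t with _ | ⟨i, o⟩
  · rw [conf_succ_of_none hσ]
  · have hk : k ≠ i := by
      rintro rfl
      exact h o hσ
    rw [conf_succ_of_some hσ]
    simp only [stepConfig, regAfter]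
    rcases I.action (I.conf σ t) i o with _ | _ <;> simp [hk]

theorem loc_succ_self {t : ℕ} {k : Fin f} {o : Op m V} (h : σ t = some (k, o)) :
    (I.conf σ (t + 1)).loc k = (I.outcome (I.conf σ t) k o).getLeft? := by
  rw [conf_succ_of_some h]
  simp [stepConfig]

theorem loc_succ_eq_none_iff {t : ℕ} {k : Fin f} {o : Op m V} (h : σ t = some (k, o)) :
    (I.conf σ (t + 1)).loc k = none ↔ ∃ r, I.Responds σ t k r := by
  rw [loc_succ_self h]
  constructor
  · intro hn
    rcases ho : I.outcome (I.conf σ t) k o with l | r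
    · simp [ho] at hn
    · exact ⟨r, o, h, ho⟩
  · rintro ⟨r, o', h', ho⟩
    rw [h] at h'
    cases h'
    simp [ho]

theorem opStart_succ_of_begins {s : ℕ} {k : Fin f} {o : Op m V} (h : I.Begins σ s k o) :
    I.opStart σ (s + 1) k = s := by
  simp [opStart, h.1, h.2]

theorem opStart_succ_of_loc {t : ℕ} {k : Fin f} (h : (I.conf σ t).loc k ≠ none) :
    I.opStart σ (t + 1) k = I.opStart σ t k := by
  simp [opStart, h]

theorem opStart_succ_of_ne {t : ℕ} {k : Fin f} (h : ∀ o, σ t ≠ some (k, o)) :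
    I.opStart σ (t + 1) k = I.opStart σ t k := by
  simp [opStart, h]

theorem Begins.eq {s : ℕ} {k k' : Fin f} {o o' : Op m V} (h : I.Begins σ s k o)
    (h' : I.Begins σ s k' o') : k = k' ∧ o = o' := by
  have := h.1.symm.trans h'.1
  simpa using this

theorem exists_begins_opStart {t : ℕ} {k : Fin f} (h : (I.conf σ t).loc k ≠ none) :
    I.opStart σ t k < t ∧ (∃ o, I.Begins σ (I.opStart σ t k) k o) ∧
      ∀ v, I.opStart σ t k ≤ v → v < t → ∀ r, ¬ I.Responds σ v k r := by
  induction t with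
  | zero => exact absurd rfl h
  | succ t ih =>
    by_cases hk : ∃ o, σ t = some (k, o)
    · obtain ⟨o, ho⟩ := hk
      have hr : ∀ r, ¬ I.Responds σ t k r := by
        intro r hr
        exact h ((loc_succ_eq_none_iff ho).2 ⟨r, hr⟩)
      by_cases hl : (I.conf σ t).loc k = none
      · have hb : I.Begins σ t k o := ⟨ho, hl⟩
        rw [opStart_succ_of_begins hb]
        refine ⟨by omega, ⟨o, hb⟩, fun v h1 h2 => ?_⟩
        obtain rfl : v = t := by omega
        exact hr
      · obtain ⟨h1, h2, h3⟩ := ih hl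
        rw [opStart_succ_of_loc hl]
        refine ⟨by omega, h2, fun v h4 h5 => ?_⟩
        rcases Nat.lt_succ_iff_lt_or_eq.1 h5 with h5 | rfl
        · exact h3 v h4 h5
        · exact hr
    · push Not at hk
      rw [loc_succ_of_ne hk] at h
      obtain ⟨h1, h2, h3⟩ := ih h
      rw [opStart_succ_of_ne hk]
      refine ⟨by omega, h2, fun v h4 h5 => ?_⟩
      rcases Nat.lt_succ_iff_lt_or_eq.1 h5 with h5 | rfl
      · exact h3 v h4 h5
      · rintro r ⟨o, ho, -⟩
        exact hk o ho

theorem opStart_eq_of_begins {s t : ℕ} {k : Fin f} {o : Op m V} (hb : I.Begins σ s k o)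
    (hst : s < t) (h : ∀ v, s ≤ v → v < t → ∀ r, ¬ I.Responds σ v k r) :
    (I.conf σ t).loc k ≠ none ∧ I.opStart σ t k = s := by
  induction t, hst using Nat.le_induction with
  | base =>
    refine ⟨fun hn => ?_, opStart_succ_of_begins hb⟩
    obtain ⟨r, hr⟩ := (loc_succ_eq_none_iff hb.1).1 hn
    exact h s le_rfl (by omega) r hr
  | succ t ht ih =>
    obtain ⟨h1, h2⟩ := ih fun v h1 h2 => h v h1 (by omega)
    refine ⟨fun hn => ?_, by rw [opStart_succ_of_loc h1, h2]⟩
    by_cases hk : ∃ o, σ t = some (k, o)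
    · obtain ⟨o', ho'⟩ := hk
      obtain ⟨r, hr⟩ := (loc_succ_eq_none_iff ho').1 hn
      exact h t (by omega) (by omega) r hr
    · push Not at hk
      rw [loc_succ_of_ne hk] at hn
      exact h1 hn

theorem exists_completes {s t : ℕ} {k : Fin f} {o : Op m V} (hb : I.Begins σ s k o)
    (h : ∃ v, s ≤ v ∧ v < t ∧ ∃ r, I.Responds σ v k r) :
    ∃ e r, e < t ∧ I.Completes σ k o s e r := by
  classical
  have h' : ∃ v, s ≤ v ∧ ∃ r, I.Responds σ v k r := by
    obtain ⟨v, h1, -, h2⟩ := h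
    exact ⟨v, h1, h2⟩
  obtain ⟨h1, r, hr⟩ := Nat.find_spec h'
  obtain ⟨v, hv, hvt, hv'⟩ := h
  refine ⟨Nat.find h', r, (Nat.find_min' h' ⟨hv, hv'⟩).trans_lt hvt, hb, h1, hr, ?_⟩
  intro v' h2 h3 r' hr'
  exact Nat.find_min h' h3 ⟨h2, r', hr'⟩

theorem inInterval_iff {s t : ℕ} {k : Fin f} {o : Op m V} :
    I.InInterval σ k o s t ↔
      I.Begins σ s k o ∧ s ≤ t ∧ ∀ v, s ≤ v → v < t → ∀ r, ¬ I.Responds σ v k r := by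
  constructor
  · rintro ⟨hb, hst, h⟩
    refine ⟨hb, hst, fun v h1 h2 r hr => ?_⟩
    obtain ⟨e, r', he, hc⟩ := exists_completes hb ⟨v, h1, h2, r, hr⟩
    have := h e r' hc
    omega
  · rintro ⟨hb, hst, h⟩
    refine ⟨hb, hst, fun e r hc => ?_⟩
    by_contra hlt
    exact h e hc.2.1 (by omega) r hc.2.2.1

theorem inInterval_opStart {t : ℕ} {k : Fin f} {o : Op m V} (h : (I.conf σ t).loc k ≠ none)
    (ho : I.Begins σ (I.opStart σ t k) k o) : I.InInterval σ k o (I.opStart σ t k) t := by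
  obtain ⟨h1, -, h3⟩ := exists_begins_opStart h
  exact inInterval_iff.2 ⟨ho, h1.le, h3⟩

theorem InInterval.opStart_eq {s t : ℕ} {k : Fin f} {o : Op m V} (h : I.InInterval σ k o s t)
    (hst : s < t) : (I.conf σ t).loc k ≠ none ∧ I.opStart σ t k = s := by
  obtain ⟨hb, -, h⟩ := inInterval_iff.1 h
  exact opStart_eq_of_begins hb hst h

theorem Completes.inInterval {s e : ℕ} {k : Fin f} {o : Op m V} {r : Response m V}
    (h : I.Completes σ k o s e r) : I.InInterval σ k o s e :=
  inInterval_iff.2 ⟨h.1, h.2.1, h.2.2.2⟩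

theorem InInterval.mono {s t t' : ℕ} {k : Fin f} {o : Op m V} (h : I.InInterval σ k o s t)
    (h1 : s ≤ t') (h2 : t' ≤ t) : I.InInterval σ k o s t' :=
  ⟨h.1, h1, fun e r hc => h2.trans (h.2.2 e r hc)⟩

/-- An operation that is no longer the current one of its process has been completed. -/
theorem exists_completes_of_opStart_ne {s t : ℕ} {k : Fin f} {o : Op m V}
    (hb : I.Begins σ s k o) (hst : s < t) (h : I.opStart σ t k ≠ s) :
    ∃ e r, I.Completes σ k o s e r := by
  by_contra hc
  push Not at hc
  exact h (opStart_eq_of_begins hb hst fun v h1 h2 r hr => by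
    obtain ⟨e, r', -, hc'⟩ := exists_completes hb ⟨v, h1, h2, r, hr⟩
    exact hc e r' hc').2

theorem Blocked.inInterval {s t : ℕ} {k : Fin f} {o : Op m V} (h : I.Blocked σ k o s)
    (hst : s ≤ t) : I.InInterval σ k o s t :=
  ⟨h.1, hst, fun e r hc => absurd hc (h.2.2 e r)⟩

end Implementation

/-! ### Event sequences made from batches of events -/

namespace EventSeq

/-- Run through the batches `E 0, E 1, …`: the value `(t, r)` at `p` says that position `p` is
the `r`'th position of the batch `E t`. Each batch is followed by one empty position. -/
def cursor (E : ℕ → List (Event m V)) : ℕ → ℕ × ℕ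
  | 0 => (0, 0)
  | p + 1 =>
    if (cursor E p).2 < (E (cursor E p).1).length then ((cursor E p).1, (cursor E p).2 + 1)
    else ((cursor E p).1 + 1, 0)

/-- The concatenation of the batches `E 0, E 1, …`, where the events of `E t` are placed at
time `t`. -/
def ofBatches (E : ℕ → List (Event m V)) : EventSeq m V where
  event p := (E (cursor E p).1)[(cursor E p).2]?
  time p := (cursor E p).1

/-- The contents of the augmented snapshot before the batch `E t`. -/
def contentsAt (E : ℕ → List (Event m V)) : ℕ → View m V
  | 0 => fun _ => none
  | t + 1 => (E t).foldl (fun w x => x.apply w) (contentsAt E t)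

variable {E : ℕ → List (Event m V)}

theorem cursor_snd_le (p : ℕ) : (cursor E p).2 ≤ (E (cursor E p).1).length := by
  cases p with
  | zero => simp [cursor]
  | succ p =>
    rw [cursor]
    split
    · simp only; omega
    · simp

theorem contents_ofBatches (p : ℕ) : (ofBatches E).contents p =
    ((E (cursor E p).1).take (cursor E p).2).foldl (fun w x => x.apply w)
      (contentsAt E (cursor E p).1) := by
  induction p with
  | zero => simp [contents, cursor, contentsAt]
  | succ p ih =>
    have hle := cursor_snd_le (E := E) p
    rw [contents, cursor]
    split_ifs with h
    · have he : (ofBatches E).event p = some ((E (cursor E p).1)[(cursor E p).2]) := by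
        simp [ofBatches, h]
      rw [he]
      simp only [List.take_add_one, List.foldl_append, ih]
      simp [h]
    · have hn : (cursor E p).2 = (E (cursor E p).1).length := by omega
      have he : (ofBatches E).event p = none := by
        simp [ofBatches, hn]
      rw [he]
      simp only [ih, hn, List.take_length, List.take_zero, List.foldl_nil, contentsAt]

theorem cursor_lt {p q : ℕ} (h : p < q) : (cursor E p).1 < (cursor E q).1 ∨
    (cursor E p).1 = (cursor E q).1 ∧ (cursor E p).2 < (cursor E q).2 := by
  induction q, h using Nat.le_induction with
  | base =>
    rw [cursor]
    split_ifs <;> simp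
  | succ q _ ih =>
    rw [cursor]
    split_ifs
    · simp only; omega
    · simp only; omega

theorem cursor_fst_mono : Monotone fun p => (cursor E p).1 := by
  intro p q h
  rcases h.lt_or_eq with h | rfl
  · have := cursor_lt (E := E) h
    simp only; omega
  · exact le_rfl

theorem cursor_injective : Function.Injective (cursor E) := by
  intro p q h
  by_contra hne
  rcases Nat.lt_or_gt_of_ne hne with hlt | hlt <;>
  · have := cursor_lt (E := E) hlt
    rw [h] at this
    omega

theorem exists_cursor_eq {t r : ℕ} (hr : r ≤ (E t).length) : ∃ p, cursor E p = (t, r) := by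
  have key : ∀ t, (∃ p, cursor E p = (t, 0)) → ∀ r ≤ (E t).length, ∃ p, cursor E p = (t, r) := by
    intro t h0 r
    induction r with
    | zero => exact fun _ => h0
    | succ r ih =>
      intro hr
      obtain ⟨p, hp⟩ := ih (by omega)
      refine ⟨p + 1, ?_⟩
      rw [cursor, hp, if_pos (by simp only; omega)]
  have h0 : ∀ t, ∃ p, cursor E p = (t, 0) := by
    intro t
    induction t with
    | zero => exact ⟨0, rfl⟩
    | succ t ih =>
      obtain ⟨p, hp⟩ := key t ih _ le_rfl
      exact ⟨p + 1, by rw [cursor, hp]; simp⟩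
  exact key t (h0 t) r hr

theorem exists_event_of_mem {t : ℕ} {x : Event m V} (h : x ∈ E t) :
    ∃ p, (ofBatches E).event p = some x ∧ (cursor E p).1 = t := by
  obtain ⟨r, hr, rfl⟩ := List.mem_iff_getElem.1 h
  obtain ⟨p, hp⟩ := exists_cursor_eq (E := E) (t := t) hr.le
  exact ⟨p, by simp [ofBatches, hp, hr], by rw [hp]⟩

theorem mem_of_event {p : ℕ} {x : Event m V} (h : (ofBatches E).event p = some x) :
    x ∈ E (cursor E p).1 :=
  List.mem_of_getElem? h

/-- Events occur once in the concatenation of the batches if they occur in one batch only, and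
once in that batch. -/
theorem ofBatches_once (hn : ∀ t, (E t).Nodup) (hd : ∀ t t' x, x ∈ E t → x ∈ E t' → t = t')
    {p q : ℕ} {x : Event m V} (hp : (ofBatches E).event p = some x)
    (hq : (ofBatches E).event q = some x) : p = q := by
  have ht := hd _ _ _ (mem_of_event hp) (mem_of_event hq)
  apply cursor_injective (E := E)
  refine Prod.ext ht ?_
  simp only [ofBatches] at hp hq
  rw [← ht] at hq
  obtain ⟨h1, h2⟩ := List.getElem?_eq_some_iff.1 hp
  obtain ⟨h3, h4⟩ := List.getElem?_eq_some_iff.1 hq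
  exact ((hn _).getElem_inj_iff).1 (h2.trans h4.symm)

theorem foldl_apply_of_forall_ne {L : List (Event m V)} {j : Fin m}
    (h : ∀ s v, Event.update s j v ∉ L) (w : View m V) :
    L.foldl (fun w x => x.apply w) w j = w j := by
  induction L generalizing w with
  | nil => rfl
  | cons x L ih =>
    rw [List.foldl_cons, ih fun s v hm => h s v (List.mem_cons_of_mem _ hm)]
    cases x with
    | scan s => rfl
    | update s j' v =>
      have : j ≠ j' := by
        rintro rfl
        exact h s v List.mem_cons_self
      simp [Event.apply, this]

theorem foldl_apply_of_mem {L : List (Event m V)} {j : Fin m} {v : V}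
    (h : ∀ s v', Event.update s j v' ∈ L → v' = v) (hm : ∃ s, Event.update s j v ∈ L)
    (w : View m V) : L.foldl (fun w x => x.apply w) w j = some v := by
  induction L generalizing w with
  | nil => simp at hm
  | cons x L ih =>
    rw [List.foldl_cons]
    by_cases hL : ∃ s, Event.update s j v ∈ L
    · exact ih (fun s v' hm => h s v' (List.mem_cons_of_mem _ hm)) hL _
    · obtain ⟨s, hs⟩ := hm
      rcases List.mem_cons.1 hs with rfl | hs
      · rw [foldl_apply_of_forall_ne]
        · simp [Event.apply]
        · intro s' v' hm
          obtain rfl := h s' v' (List.mem_cons_of_mem _ hm)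
          exact hL ⟨s', hm⟩
      · exact absurd ⟨s, hs⟩ hL

end EventSeq

/-! ### The implementation -/

/-- What a Block-Update appends to its process's component of `H`: its argument and its
timestamp. Timestamps are ordered lexicographically. -/
structure Block (f m : ℕ) (V : Type u) : Type u where
  arg : BlockArg m V
  stamp : Lex (Fin f → ℕ)

/-- The blocks appended by each process, in order. -/
abbrev History (f m : ℕ) (V : Type u) : Type u := Fin f → List (Block f m V)

/-- The content of a component of `H`: the blocks appended by its process, and the histories
that the process has seen and announced to the others. -/
structure Register (f m : ℕ) (V : Type u) : Type u where
  blocks : List (Block f m V)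
  log : List (History f m V)

/-- The history contained in the value of `H`. -/
def historyOf (H : Fin f → Register f m V) : History f m V := fun i => (H i).blocks

namespace History

/-- The total number of blocks. -/
def size (c : History f m V) : ℕ := ∑ i, (c i).length

/-- The timestamp of a Block-Update by process `k` that has seen the history `c`: the number of
blocks of each process, counting its own block to come. -/
def nextStamp (c : History f m V) (k : Fin f) : Lex (Fin f → ℕ) :=
  toLex fun i => (c i).length + if i = k then 1 else 0

/-- The block of some process in `c` that has the largest timestamp among the blocks that update
component `j` updates it to `v`. -/
def IsLastValue (c : History f m V) (j : Fin m) (v : V) : Prop :=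
  ∃ i, ∃ b ∈ c i, (j, v) ∈ b.arg.pairs ∧
    ∀ i', ∀ b' ∈ c i', (∃ v', (j, v') ∈ b'.arg.pairs) → b'.stamp ≤ b.stamp

open Classical in
/-- The view given by a history: each component has the value that the block with the largest
timestamp updates it to. -/
noncomputable def toView (c : History f m V) : View m V := fun j =>
  if h : ∃ v, c.IsLastValue j v then some h.choose else none

/-- The histories that the processes have announced in `H` and that contain as many blocks of
process `i` as `c` does, and `c` itself. -/
def candidates (i : Fin f) (c : History f m V) (H : Fin f → Register f m V) :
    List (History f m V) :=
  c :: ((List.finRange f).flatMap fun k => (H k).log).filter fun d =>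
    decide ((d i).length = (c i).length)

/-- A largest one among the candidates. -/
def latest (i : Fin f) (c : History f m V) (H : Fin f → Register f m V) : History f m V :=
  ((candidates i c H).argmax size).getD c

theorem mem_candidates {i : Fin f} {c d : History f m V} {H : Fin f → Register f m V} :
    d ∈ candidates i c H ↔ d = c ∨ (∃ k, d ∈ (H k).log) ∧ (d i).length = (c i).length := by
  simp [candidates]

theorem latest_mem_argmax (i : Fin f) (c : History f m V) (H : Fin f → Register f m V) :
    latest i c H ∈ (candidates i c H).argmax size := by
  rcases h : (candidates i c H).argmax size with _ | d
  · simp [candidates, List.argmax_eq_none] at h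
  · simp [latest, h]

theorem latest_mem (i : Fin f) (c : History f m V) (H : Fin f → Register f m V) :
    latest i c H ∈ candidates i c H :=
  List.argmax_mem (latest_mem_argmax i c H)

theorem size_le_size_latest {i : Fin f} {c d : History f m V} {H : Fin f → Register f m V}
    (h : d ∈ candidates i c H) : d.size ≤ (latest i c H).size :=
  List.le_of_mem_argmax h (latest_mem_argmax i c H)

/-- The timestamps in `c` count blocks of `c` only. -/
def Bounded (c : History f m V) : Prop :=
  ∀ i, ∀ b ∈ c i, ∀ l, ofLex b.stamp l ≤ (c l).length

/-- A timestamp is larger than all those in `c` if it counts one more block of process `k`, and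
exactly the blocks in `c` of the processes below `k`. -/
theorem Bounded.lt_nextStamp {c d : History f m V} (hc : c.Bounded) {k : Fin f}
    (hk : (c k).length = (d k).length) (hlt : ∀ l < k, (c l).length = (d l).length)
    {i : Fin f} {b : Block f m V} (hb : b ∈ c i) : b.stamp < d.nextStamp k := by
  by_contra hle
  have hbk := hc i b hb k
  rcases (not_lt.1 hle).lt_or_eq with h | h
  · obtain ⟨l, hl, hl'⟩ := h
    replace hl : ∀ j < l, (d j).length + (if j = k then 1 else 0) = ofLex b.stamp j := hl
    replace hl' : (d l).length + (if l = k then 1 else 0) < ofLex b.stamp l := hl'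
    have hbl := hc i b hb l
    rcases lt_trichotomy l k with h1 | rfl | h1
    · have := hlt l h1
      rw [if_neg h1.ne] at hl'
      omega
    · rw [if_pos rfl] at hl'
      omega
    · have := hl k h1
      rw [if_pos rfl] at this
      omega
  · rw [← h] at hbk
    simp [nextStamp] at hbk
    omega

theorem Bounded.stamp_ne_nextStamp {c d : History f m V} (hc : c.Bounded) {k : Fin f}
    (hk : (c k).length = (d k).length) {i : Fin f} {b : Block f m V} (hb : b ∈ c i) :
    b.stamp ≠ d.nextStamp k := by
  intro h
  have hbk := hc i b hb k
  rw [h] at hbk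
  simp [nextStamp] at hbk
  omega

/-- All blocks in `c` that update component `j` have timestamps smaller than `t`. -/
def Uncovered (c : History f m V) (j : Fin m) (t : Lex (Fin f → ℕ)) : Prop :=
  ∀ i, ∀ b ∈ c i, (∃ v, (j, v) ∈ b.arg.pairs) → b.stamp < t

/-- Process `k` appends the block `b` to its blocks in `c`. -/
def append (c : History f m V) (k : Fin f) (b : Block f m V) : History f m V :=
  Function.update c k (c k ++ [b])

theorem mem_append {c : History f m V} {k i : Fin f} {b b' : Block f m V} :
    b' ∈ c.append k b i ↔ b' ∈ c i ∨ i = k ∧ b' = b := by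
  by_cases h : i = k
  · subst h
    simp [append]
  · simp [append, h]

theorem length_append (c : History f m V) (k i : Fin f) (b : Block f m V) :
    (c.append k b i).length = (c i).length + if i = k then 1 else 0 := by
  by_cases h : i = k
  · subst h
    simp [append]
  · simp [append, h]

theorem size_append (c : History f m V) (k : Fin f) (b : Block f m V) :
    (c.append k b).size = c.size + 1 := by
  simp [size, length_append, Finset.sum_add_distrib]

end History

theorem BlockArg.value_unique {a : BlockArg m V} {j : Fin m} {v v' : V} (h : (j, v) ∈ a.pairs)
    (h' : (j, v') ∈ a.pairs) : v = v' := by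
  have := List.inj_on_of_nodup_map a.distinct h h' rfl
  simpa using this

namespace History

theorem toView_append_of_uncovered {c : History f m V} {k : Fin f} {b : Block f m V}
    {j : Fin m} {v : V} (hv : (j, v) ∈ b.arg.pairs) (hu : c.Uncovered j b.stamp) :
    (c.append k b).toView j = some v := by
  have key : ∀ v', (c.append k b).IsLastValue j v' ↔ v' = v := by
    intro v'
    constructor
    · rintro ⟨i, b', hb', hv', hmax⟩
      rcases mem_append.1 hb' with h | ⟨-, rfl⟩
      · exact absurd (hmax k b (mem_append.2 (Or.inr ⟨rfl, rfl⟩)) ⟨v, hv⟩)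
          (not_le.2 (hu i b' h ⟨v', hv'⟩))
      · exact BlockArg.value_unique hv' hv
    · rintro rfl
      refine ⟨k, b, mem_append.2 (Or.inr ⟨rfl, rfl⟩), hv, fun i' b' hb' hj => ?_⟩
      rcases mem_append.1 hb' with h | ⟨-, rfl⟩
      · exact (hu i' b' h hj).le
      · exact le_rfl
  have hex : ∃ v', (c.append k b).IsLastValue j v' := ⟨v, (key v).2 rfl⟩
  rw [toView, dif_pos hex, (key _).1 hex.choose_spec]

theorem toView_append_of_covered {c : History f m V} {k : Fin f} {b : Block f m V} {j : Fin m}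
    (hu : (∃ v, (j, v) ∈ b.arg.pairs) → ¬ c.Uncovered j b.stamp)
    (hne : ∀ i, ∀ b' ∈ c i, b'.stamp ≠ b.stamp) :
    (c.append k b).toView j = c.toView j := by
  have key : (c.append k b).IsLastValue j = c.IsLastValue j := by
    ext v
    constructor
    · rintro ⟨i, b', hb', hv', hmax⟩
      rcases mem_append.1 hb' with h | ⟨-, rfl⟩
      · exact ⟨i, b', h, hv', fun i'' b'' h'' => hmax i'' b'' (mem_append.2 (Or.inl h''))⟩
      · refine absurd (fun i'' b'' h'' hj => ?_) (hu ⟨v, hv'⟩)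
        exact (hmax i'' b'' (mem_append.2 (Or.inl h'')) hj).lt_of_ne (hne i'' b'' h'')
    · rintro ⟨i, b', hb', hv', hmax⟩
      refine ⟨i, b', mem_append.2 (Or.inl hb'), hv', fun i'' b'' h'' hj => ?_⟩
      rcases mem_append.1 h'' with h | ⟨-, rfl⟩
      · exact hmax i'' b'' h hj
      · have := hu hj
        simp only [Uncovered, not_forall] at this
        obtain ⟨i3, b3, h3, hj3, hle⟩ := this
        exact (not_lt.1 hle).trans (hmax i3 b3 h3 hj3)
  unfold toView
  rw [key]

end History

/-- The local states of a process that is carrying out an operation. -/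
inductive LocalState (f m : ℕ) (V : Type u) : Type u where
  /-- about to take the first step of the operation, a scan of `H` -/
  | fresh (o : Op m V) : LocalState f m V
  /-- in a Scan: about to announce the history in `H` -/
  | announceScan (H : Fin f → Register f m V) : LocalState f m V
  /-- in a Scan: about to check that the history is still `c` -/
  | recheck (c : History f m V) : LocalState f m V
  /-- in a Block-Update: about to append the block, after `H` was scanned -/
  | append (a : BlockArg m V) (H : Fin f → Register f m V) : LocalState f m V
  /-- in a Block-Update: about to scan `H` after the block was appended -/
  | collect (H : Fin f → Register f m V) : LocalState f m V
  /-- in a Block-Update: about to announce the history in `G` -/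
  | announceBlock (H G : Fin f → Register f m V) : LocalState f m V
  /-- in a Block-Update: about to scan `H` for the last time -/
  | finish (H : Fin f → Register f m V) : LocalState f m V

/-- The register in which the history in `H` is also announced. -/
def Register.announce (H : Fin f → Register f m V) (k : Fin f) : Register f m V where
  blocks := (H k).blocks
  log := historyOf H :: (H k).log

open Classical in
/-- The step that process `k` is about to take in a local state. A Scan repeatedly scans `H` and
announces the history that it found, until the history does not change. A Block-Update scans `H`,
appends its block, scans again and announces the history, and scans a last time; it yields if a
block of a lower process has been appended in the meantime, and otherwise returns the view of the
largest history known to have been seen by some process before its own block was appended. -/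
noncomputable def helpingCode (k : Fin f) :
    LocalState f m V → Action f m V (Register f m V) (LocalState f m V)
  | .fresh .scan => .scan fun H => .inl (.announceScan H)
  | .fresh (.blockUpdate a) => .scan fun H => .inl (.append a H)
  | .announceScan H => .update (Register.announce H k) (.inl (.recheck (historyOf H)))
  | .recheck c => .scan fun H =>
      if historyOf H = c then .inr (.view c.toView) else .inl (.announceScan H)
  | .append a H => .update ⟨(H k).blocks ++ [⟨a, (historyOf H).nextStamp k⟩], (H k).log⟩
      (.inl (.collect H))
  | .collect H => .scan fun G => .inl (.announceBlock H G)
  | .announceBlock H G => .update (Register.announce G k) (.inl (.finish H))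
  | .finish H => .scan fun H' =>
      .inr (if ∃ i < k, (H i).blocks.length < (H' i).blocks.length then .yield
        else .view (History.latest k (historyOf H) H').toView)

/-- The augmented snapshot from `H`. -/
noncomputable def helpingSnapshot (f m : ℕ) (V : Type u) : Implementation f m V where
  Reg := Register f m V
  init := ⟨[], []⟩
  Loc := LocalState f m V
  start _ o := .fresh o
  code := helpingCode

namespace HelpingSnapshot

variable {σ : Schedule f m V}

/-- The value of `H` just before time `t`. -/
noncomputable def reg (σ : Schedule f m V) (t : ℕ) : Fin f → Register f m V :=
  ((helpingSnapshot f m V).conf σ t).reg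

/-- The local state of process `k` just before time `t`. -/
noncomputable def loc (σ : Schedule f m V) (t : ℕ) (k : Fin f) : Option (LocalState f m V) :=
  ((helpingSnapshot f m V).conf σ t).loc k

/-- The history just before time `t`. -/
noncomputable def hist (σ : Schedule f m V) (t : ℕ) : History f m V := historyOf (reg σ t)

/-- The time at which the latest operation of process `k` before time `t` was begun. -/
noncomputable abbrev opStart (σ : Schedule f m V) (t : ℕ) (k : Fin f) : ℕ :=
  (helpingSnapshot f m V).opStart σ t k

theorem hist_apply (t : ℕ) (k : Fin f) : hist σ t k = (reg σ t k).blocks := rfl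

theorem action_eq (t : ℕ) (k : Fin f) (o : Op m V) :
    (helpingSnapshot f m V).action ((helpingSnapshot f m V).conf σ t) k o =
      helpingCode k ((loc σ t k).getD (.fresh o)) := rfl

theorem step_scan {t : ℕ} {k : Fin f} {o : Op m V}
    {c : (Fin f → Register f m V) → LocalState f m V ⊕ Response m V} (h : σ t = some (k, o))
    (ha : helpingCode k ((loc σ t k).getD (.fresh o)) = .scan c) :
    reg σ (t + 1) = reg σ t ∧ loc σ (t + 1) k = (c (reg σ t)).getLeft? ∧
      ∀ r, (helpingSnapshot f m V).Responds σ t k r ↔ c (reg σ t) = .inr r := by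
  rw [← action_eq] at ha
  have ho : (helpingSnapshot f m V).outcome ((helpingSnapshot f m V).conf σ t) k o =
      c (reg σ t) := by
    unfold Implementation.outcome
    rw [ha]
    rfl
  refine ⟨?_, ?_, fun r => ⟨?_, fun hr => ⟨o, h, ho.trans hr⟩⟩⟩
  · unfold reg
    rw [Implementation.conf_succ_of_some h]
    unfold Implementation.stepConfig Implementation.regAfter
    rw [ha]
  · rw [loc, Implementation.loc_succ_self h, ho]
    rfl
  · rintro ⟨o', h', hr⟩
    rw [h] at h'
    cases h'
    exact ho.symm.trans hr

theorem step_update {t : ℕ} {k : Fin f} {o : Op m V} {x : Register f m V}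
    {l : LocalState f m V} (h : σ t = some (k, o))
    (ha : helpingCode k ((loc σ t k).getD (.fresh o)) = .update x (.inl l)) :
    reg σ (t + 1) = Function.update (reg σ t) k x ∧ loc σ (t + 1) k = some l ∧
      ∀ r, ¬ (helpingSnapshot f m V).Responds σ t k r := by
  rw [← action_eq] at ha
  have ho : (helpingSnapshot f m V).outcome ((helpingSnapshot f m V).conf σ t) k o = .inl l := by
    unfold Implementation.outcome
    rw [ha]
    rfl
  refine ⟨?_, ?_, ?_⟩
  · unfold reg
    rw [Implementation.conf_succ_of_some h]
    unfold Implementation.stepConfig Implementation.regAfter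
    rw [ha]
    rfl
  · rw [loc, Implementation.loc_succ_self h, ho]
    rfl
  · rintro r ⟨o', h', hr⟩
    rw [h] at h'
    cases h'
    rw [ho] at hr
    cases hr

theorem step_fresh_scan {t : ℕ} {k : Fin f} (h : σ t = some (k, .scan)) (hl : loc σ t k = none) :
    reg σ (t + 1) = reg σ t ∧ loc σ (t + 1) k = some (.announceScan (reg σ t)) := by
  obtain ⟨h1, h2, -⟩ := step_scan (c := fun H => .inl (.announceScan H)) h (by rw [hl]; rfl)
  exact ⟨h1, h2⟩

theorem step_fresh_block {t : ℕ} {k : Fin f} {a : BlockArg m V}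
    (h : σ t = some (k, .blockUpdate a)) (hl : loc σ t k = none) :
    reg σ (t + 1) = reg σ t ∧ loc σ (t + 1) k = some (.append a (reg σ t)) := by
  obtain ⟨h1, h2, -⟩ := step_scan (c := fun H => .inl (.append a H)) h (by rw [hl]; rfl)
  exact ⟨h1, h2⟩

variable {t : ℕ} {k : Fin f} {o : Op m V} {a : BlockArg m V} {H G : Fin f → Register f m V}
  {c : History f m V}

theorem step_announceScan (h : σ t = some (k, o)) (hl : loc σ t k = some (.announceScan H)) :
    reg σ (t + 1) = Function.update (reg σ t) k (Register.announce H k) ∧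
      loc σ (t + 1) k = some (.recheck (historyOf H)) := by
  obtain ⟨h1, h2, -⟩ := step_update h (x := Register.announce H k) (l := .recheck (historyOf H))
    (by rw [hl]; rfl)
  exact ⟨h1, h2⟩

theorem step_recheck_eq (h : σ t = some (k, o)) (hl : loc σ t k = some (.recheck c))
    (hc : hist σ t = c) :
    reg σ (t + 1) = reg σ t ∧ loc σ (t + 1) k = none ∧
      ∀ r, (helpingSnapshot f m V).Responds σ t k r ↔ .view c.toView = r := by
  classical
  obtain ⟨h1, h2, h3⟩ := step_scan (c := fun H =>
    if historyOf H = c then .inr (.view c.toView) else .inl (.announceScan H)) h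
    (by rw [hl]; simp only [Option.getD_some, helpingCode])
  have hc' : historyOf (reg σ t) = c := hc
  simp only [hc', if_true] at h2 h3
  refine ⟨h1, h2, fun r => (h3 r).trans ?_⟩
  simp

theorem step_recheck_ne (h : σ t = some (k, o)) (hl : loc σ t k = some (.recheck c))
    (hc : hist σ t ≠ c) :
    reg σ (t + 1) = reg σ t ∧ loc σ (t + 1) k = some (.announceScan (reg σ t)) := by
  classical
  obtain ⟨h1, h2, -⟩ := step_scan (c := fun H =>
    if historyOf H = c then .inr (.view c.toView) else .inl (.announceScan H)) h
    (by rw [hl]; simp only [Option.getD_some, helpingCode])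
  have hc' : historyOf (reg σ t) ≠ c := hc
  simp only [hc', if_false] at h2
  exact ⟨h1, h2⟩

theorem step_append (h : σ t = some (k, o)) (hl : loc σ t k = some (.append a H)) :
    reg σ (t + 1) = Function.update (reg σ t) k
        ⟨(H k).blocks ++ [⟨a, (historyOf H).nextStamp k⟩], (H k).log⟩ ∧
      loc σ (t + 1) k = some (.collect H) := by
  obtain ⟨h1, h2, -⟩ := step_update h
    (x := ⟨(H k).blocks ++ [⟨a, (historyOf H).nextStamp k⟩], (H k).log⟩) (l := .collect H)
    (by rw [hl]; rfl)
  exact ⟨h1, h2⟩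

theorem step_collect (h : σ t = some (k, o)) (hl : loc σ t k = some (.collect H)) :
    reg σ (t + 1) = reg σ t ∧ loc σ (t + 1) k = some (.announceBlock H (reg σ t)) := by
  obtain ⟨h1, h2, -⟩ := step_scan (c := fun G => .inl (.announceBlock H G)) h (by rw [hl]; rfl)
  exact ⟨h1, h2⟩

theorem step_announceBlock (h : σ t = some (k, o))
    (hl : loc σ t k = some (.announceBlock H G)) :
    reg σ (t + 1) = Function.update (reg σ t) k (Register.announce G k) ∧
      loc σ (t + 1) k = some (.finish H) := by
  obtain ⟨h1, h2, -⟩ := step_update h (x := Register.announce G k) (l := .finish H)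
    (by rw [hl]; rfl)
  exact ⟨h1, h2⟩

open Classical in
theorem step_finish (h : σ t = some (k, o)) (hl : loc σ t k = some (.finish H)) :
    reg σ (t + 1) = reg σ t ∧ loc σ (t + 1) k = none ∧
      ∀ r, (helpingSnapshot f m V).Responds σ t k r ↔
        (if ∃ i < k, (H i).blocks.length < (reg σ t i).blocks.length then .yield
          else .view (History.latest k (historyOf H) (reg σ t)).toView) = r := by
  obtain ⟨h1, h2, h3⟩ := step_scan (c := fun H' =>
    .inr (if ∃ i < k, (H i).blocks.length < (H' i).blocks.length then .yield
      else .view (History.latest k (historyOf H) H').toView)) h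
    (by rw [hl]; simp only [Option.getD_some, helpingCode])
  refine ⟨h1, h2, fun r => (h3 r).trans ?_⟩
  rw [Sum.inr.injEq]

/-! ### Invariants of the executions -/

/-- What is known just before time `t` if process `k` is in a given local state. -/
def StateFacts (σ : Schedule f m V) (t : ℕ) (k : Fin f) : LocalState f m V → Prop
  | .fresh _ => False
  | .announceScan H => (helpingSnapshot f m V).Begins σ (opStart σ t k) k .scan ∧
      reg σ t k = H k ∧ ∃ g < t, reg σ g = H
  | .recheck c => (helpingSnapshot f m V).Begins σ (opStart σ t k) k .scan ∧
      c ∈ (reg σ t k).log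
  | .append a H => (helpingSnapshot f m V).Begins σ (opStart σ t k) k (.blockUpdate a) ∧
      reg σ (opStart σ t k) = H ∧ reg σ t k = H k
  | .collect H => (∃ a, (helpingSnapshot f m V).Begins σ (opStart σ t k) k (.blockUpdate a)) ∧
      reg σ (opStart σ t k) = H ∧ (hist σ t k).length = (hist σ (opStart σ t k) k).length + 1
  | .announceBlock H G =>
      (∃ a, (helpingSnapshot f m V).Begins σ (opStart σ t k) k (.blockUpdate a)) ∧
      reg σ (opStart σ t k) = H ∧ (hist σ t k).length = (hist σ (opStart σ t k) k).length + 1 ∧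
      reg σ t k = G k ∧ ∃ g, opStart σ t k ≤ g ∧ g < t ∧ reg σ g = G
  | .finish H => (∃ a, (helpingSnapshot f m V).Begins σ (opStart σ t k) k (.blockUpdate a)) ∧
      reg σ (opStart σ t k) = H ∧ (hist σ t k).length = (hist σ (opStart σ t k) k).length + 1 ∧
      ∃ g, opStart σ t k ≤ g ∧ g < t ∧
        (hist σ g k).length = (hist σ (opStart σ t k) k).length + 1 ∧ hist σ g ∈ (reg σ t k).log

theorem opStart_lt {t : ℕ} {k : Fin f} {l : LocalState f m V} (h : loc σ t k = some l) :
    opStart σ t k < t := by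
  refine (Implementation.exists_begins_opStart (I := helpingSnapshot f m V) ?_).1
  change loc σ t k ≠ none
  simp [h]

theorem stateFacts {t : ℕ} {k : Fin f} {l : LocalState f m V} (h : loc σ t k = some l) :
    StateFacts σ t k l := by
  induction t generalizing l with
  | zero => simp [loc, Implementation.conf, Implementation.initial] at h
  | succ t ih =>
    by_cases hk : ∃ o, σ t = some (k, o)
    · obtain ⟨o, ho⟩ := hk
      rcases hl : loc σ t k with _ | l'
      · have hb : (helpingSnapshot f m V).Begins σ t k o := ⟨ho, hl⟩
        have hs : opStart σ (t + 1) k = t := Implementation.opStart_succ_of_begins hb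
        cases o with
        | scan =>
          obtain ⟨h1, h2⟩ := step_fresh_scan ho hl
          rw [h2] at h
          cases h
          refine ⟨by rwa [hs], by rw [h1], t, by omega, rfl⟩
        | blockUpdate a =>
          obtain ⟨h1, h2⟩ := step_fresh_block ho hl
          rw [h2] at h
          cases h
          exact ⟨by rwa [hs], by rw [hs], by rw [h1]⟩
      · have hs : opStart σ (t + 1) k = opStart σ t k :=
          Implementation.opStart_succ_of_loc (I := helpingSnapshot f m V)
            (by change loc σ t k ≠ none; simp [hl])
        have hlt := opStart_lt hl
        have hf := ih hl
        cases l' with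
        | fresh o => exact hf.elim
        | announceScan H =>
          obtain ⟨h1, h2⟩ := step_announceScan ho hl
          rw [h2] at h
          cases h
          refine ⟨by rw [hs]; exact hf.1, ?_⟩
          rw [h1]
          simp [Register.announce]
        | recheck c =>
          by_cases hc : hist σ t = c
          · rw [(step_recheck_eq ho hl hc).2.1] at h
            cases h
          · obtain ⟨h1, h2⟩ := step_recheck_ne ho hl hc
            rw [h2] at h
            cases h
            exact ⟨by rw [hs]; exact hf.1, by rw [h1], t, by omega, rfl⟩
        | append a H =>
          obtain ⟨h1, h2⟩ := step_append ho hl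
          rw [h2] at h
          cases h
          obtain ⟨h3, h4, h5⟩ := hf
          refine ⟨by rw [hs]; exact ⟨a, h3⟩, by rw [hs]; exact h4, ?_⟩
          simp only [hist_apply]
          rw [h1, hs, h4]
          simp
        | collect H =>
          obtain ⟨h1, h2⟩ := step_collect ho hl
          rw [h2] at h
          cases h
          obtain ⟨h3, h4, h5⟩ := hf
          refine ⟨by rw [hs]; exact h3, by rw [hs]; exact h4, ?_, by rw [h1], t, ?_, by omega, rfl⟩
          · rw [hist_apply, h1, hs, ← h5, hist_apply]
          · rw [hs]; omega
        | announceBlock H G =>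
          obtain ⟨h1, h2⟩ := step_announceBlock ho hl
          rw [h2] at h
          cases h
          obtain ⟨h3, h4, h5, h6, g, h7, h8, h9⟩ := hf
          have hg : (hist σ g k).length = (hist σ (opStart σ t k) k).length + 1 := by
            rw [← h5, hist_apply, hist_apply, h6, h9]
          refine ⟨by rw [hs]; exact h3, by rw [hs]; exact h4, ?_, g, by rw [hs]; exact h7,
            by omega, by rw [hs]; exact hg, ?_⟩
          · rw [hist_apply, h1, hs, ← h5, hist_apply, h6]
            simp [Register.announce]
          · rw [h1, hist, h9]
            simp [Register.announce]
        | finish H =>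
          rw [(step_finish ho hl).2.1] at h
          cases h
    · push Not at hk
      have h1 : loc σ (t + 1) k = loc σ t k := Implementation.loc_succ_of_ne hk
      have h2 : reg σ (t + 1) k = reg σ t k := Implementation.reg_succ_of_ne hk
      have h3 : opStart σ (t + 1) k = opStart σ t k := Implementation.opStart_succ_of_ne hk
      have h4 : hist σ (t + 1) k = hist σ t k := by rw [hist_apply, h2, hist_apply]
      rw [h1] at h
      have hf := ih h
      cases l with
      | fresh o => exact hf
      | announceScan H =>
        obtain ⟨h5, h6, g, h7, h8⟩ := hf
        exact ⟨by rwa [h3], by rwa [h2], g, by omega, h8⟩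
      | recheck c =>
        exact ⟨by rw [h3]; exact hf.1, by rw [h2]; exact hf.2⟩
      | append a H =>
        obtain ⟨h5, h6, h7⟩ := hf
        exact ⟨by rwa [h3], by rwa [h3], by rwa [h2]⟩
      | collect H =>
        obtain ⟨h5, h6, h7⟩ := hf
        exact ⟨by rwa [h3], by rwa [h3], by rwa [h3, h4]⟩
      | announceBlock H G =>
        obtain ⟨h5, h6, h7, h8, g, h9, h10, h11⟩ := hf
        exact ⟨by rwa [h3], by rwa [h3], by rwa [h3, h4], by rwa [h2], g, by rwa [h3], by omega,
          h11⟩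
      | finish H =>
        obtain ⟨h5, h6, h7, g, h8, h9, h10, h11⟩ := hf
        exact ⟨by rwa [h3], by rwa [h3], by rwa [h3, h4], g, by rwa [h3], by omega, by rwa [h3],
          by rwa [h2]⟩

/-- Process `k` is carrying out a Block-Update with argument `a`, and is about to append its
block. -/
def Pending (σ : Schedule f m V) (t : ℕ) (k : Fin f) (a : BlockArg m V) : Prop :=
  ∃ H, loc σ t k = some (.append a H)

/-- At time `t`, process `k` appends its block, in a Block-Update with argument `a`. -/
def Appends (σ : Schedule f m V) (t : ℕ) (k : Fin f) (a : BlockArg m V) : Prop :=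
  (∃ o, σ t = some (k, o)) ∧ Pending σ t k a

/-- The timestamp of the block that process `k` is about to append. -/
noncomputable def stamp (σ : Schedule f m V) (t : ℕ) (k : Fin f) : Lex (Fin f → ℕ) :=
  (hist σ (opStart σ t k)).nextStamp k

variable {t t' : ℕ} {k k' : Fin f} {a a' : BlockArg m V}

theorem Pending.begins (h : Pending σ t k a) :
    (helpingSnapshot f m V).Begins σ (opStart σ t k) k (.blockUpdate a) := by
  obtain ⟨H, h⟩ := h
  exact (stateFacts h).1

theorem Pending.lt (h : Pending σ t k a) : opStart σ t k < t := by
  obtain ⟨H, h⟩ := h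
  exact opStart_lt h

theorem Pending.hist_eq (h : Pending σ t k a) : hist σ t k = hist σ (opStart σ t k) k := by
  obtain ⟨H, h⟩ := h
  obtain ⟨-, h1, h2⟩ := stateFacts h
  rw [hist_apply, h2, ← h1, hist_apply]

theorem Pending.inInterval (h : Pending σ t k a) :
    (helpingSnapshot f m V).InInterval σ k (.blockUpdate a) (opStart σ t k) t := by
  refine Implementation.inInterval_opStart ?_ h.begins
  obtain ⟨H, h⟩ := h
  change loc σ t k ≠ none
  simp [h]

theorem Pending.arg_eq (h : Pending σ t k a) (h' : Pending σ t k a') : a = a' := by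
  obtain ⟨H, h⟩ := h
  obtain ⟨H', h'⟩ := h'
  rw [h] at h'
  cases h'
  rfl

theorem Appends.proc_eq (h : Appends σ t k a) (h' : Appends σ t k' a') : k = k' := by
  obtain ⟨⟨o, ho⟩, -⟩ := h
  obtain ⟨⟨o', ho'⟩, -⟩ := h'
  rw [ho] at ho'
  cases ho'
  rfl

theorem reg_succ_append_or {t : ℕ} {k : Fin f} {o : Op m V} (ho : σ t = some (k, o)) :
    (∃ a, Pending σ t k a ∧ reg σ (t + 1) = Function.update (reg σ t) k
      ⟨(reg σ t k).blocks ++ [⟨a, stamp σ t k⟩], (reg σ t k).log⟩) ∨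
    reg σ (t + 1) = reg σ t ∨ ∃ g ≤ t, reg σ (t + 1) = Function.update (reg σ t) k
      ⟨(reg σ t k).blocks, hist σ g :: (reg σ t k).log⟩ := by
  rcases hl : loc σ t k with _ | l
  · cases o with
    | scan => exact Or.inr (Or.inl (step_fresh_scan ho hl).1)
    | blockUpdate a => exact Or.inr (Or.inl (step_fresh_block ho hl).1)
  · have hf := stateFacts hl
    cases l with
    | fresh o => exact hf.elim
    | announceScan H =>
      obtain ⟨-, h1, g, h2, h3⟩ := hf
      refine Or.inr (Or.inr ⟨g, h2.le, ?_⟩)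
      rw [(step_announceScan ho hl).1, h1, hist, h3]
      rfl
    | recheck c =>
      by_cases hc : hist σ t = c
      · exact Or.inr (Or.inl (step_recheck_eq ho hl hc).1)
      · exact Or.inr (Or.inl (step_recheck_ne ho hl hc).1)
    | append a H =>
      refine Or.inl ⟨a, ⟨H, hl⟩, ?_⟩
      obtain ⟨-, h1, h2⟩ := hf
      rw [(step_append ho hl).1, h2, stamp, hist, h1]
    | collect H => exact Or.inr (Or.inl (step_collect ho hl).1)
    | announceBlock H G =>
      obtain ⟨-, -, -, h1, g, -, h2, h3⟩ := hf
      refine Or.inr (Or.inr ⟨g, h2.le, ?_⟩)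
      rw [(step_announceBlock ho hl).1, h1, hist, h3]
      rfl
    | finish H => exact Or.inr (Or.inl (step_finish ho hl).1)

theorem Appends.hist_succ (h : Appends σ t k a) :
    hist σ (t + 1) = (hist σ t).append k ⟨a, stamp σ t k⟩ := by
  obtain ⟨⟨o, ho⟩, H, hl⟩ := h
  obtain ⟨-, h1, h2⟩ := stateFacts hl
  subst h1
  ext1 i
  rw [hist_apply, (step_append ho hl).1, History.append]
  by_cases hi : i = k
  · subst hi
    simp [stamp, hist, historyOf, h2]
  · simp [hi, hist_apply]

theorem hist_succ_of_not_appends (h : ∀ k a, ¬ Appends σ t k a) : hist σ (t + 1) = hist σ t := by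
  rcases ho : σ t with _ | ⟨k, o⟩
  · rw [hist, reg, Implementation.conf_succ_of_none ho]
    rfl
  · rcases reg_succ_append_or ho with ⟨a, ha, -⟩ | h1 | ⟨g, -, h1⟩
    · exact absurd ⟨⟨o, ho⟩, ha⟩ (h k a)
    · rw [hist, h1, hist]
    · ext1 i
      rw [hist_apply, h1]
      by_cases hi : i = k
      · subst hi
        simp [hist_apply]
      · simp [hi, hist_apply]

theorem hist_succ_cases (σ : Schedule f m V) (t : ℕ) : hist σ (t + 1) = hist σ t ∨
    ∃ k a, Appends σ t k a ∧ hist σ (t + 1) = (hist σ t).append k ⟨a, stamp σ t k⟩ := by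
  by_cases h : ∃ k a, Appends σ t k a
  · obtain ⟨k, a, h⟩ := h
    exact Or.inr ⟨k, a, h, h.hist_succ⟩
  · push Not at h
    exact Or.inl (hist_succ_of_not_appends h)

theorem log_succ (t : ℕ) (i : Fin f) : (reg σ (t + 1) i).log = (reg σ t i).log ∨
    ∃ g ≤ t, (reg σ (t + 1) i).log = hist σ g :: (reg σ t i).log := by
  by_cases hi : ∃ o, σ t = some (i, o)
  · obtain ⟨o, ho⟩ := hi
    rcases reg_succ_append_or ho with ⟨a, -, h1⟩ | h1 | ⟨g, hg, h1⟩
    · simp [h1]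
    · simp [h1]
    · exact Or.inr ⟨g, hg, by simp [h1]⟩
  · push Not at hi
    have : reg σ (t + 1) i = reg σ t i := Implementation.reg_succ_of_ne hi
    simp [this]

theorem log_mono (i : Fin f) (h : t ≤ t') : (reg σ t i).log ⊆ (reg σ t' i).log := by
  induction t', h using Nat.le_induction with
  | base => exact List.Subset.refl _
  | succ t' _ ih =>
    rcases log_succ (σ := σ) t' i with h | ⟨g, -, h⟩
    · rw [h]; exact ih
    · rw [h]; exact fun d hd => List.mem_cons_of_mem _ (ih hd)

theorem exists_hist_of_mem_log {i : Fin f} {c : History f m V} (h : c ∈ (reg σ t i).log) :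
    ∃ g < t, hist σ g = c := by
  induction t with
  | zero => simp [reg, Implementation.conf, Implementation.initial, helpingSnapshot] at h
  | succ t ih =>
    rcases log_succ (σ := σ) t i with h1 | ⟨g, hg, h1⟩
    · rw [h1] at h
      obtain ⟨g, hg, rfl⟩ := ih h
      exact ⟨g, by omega, rfl⟩
    · rw [h1] at h
      rcases List.mem_cons.1 h with rfl | h
      · exact ⟨g, by omega, rfl⟩
      · obtain ⟨g, hg, rfl⟩ := ih h
        exact ⟨g, by omega, rfl⟩

theorem mem_hist_mono {i : Fin f} {b : Block f m V} (h : t ≤ t') (hb : b ∈ hist σ t i) :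
    b ∈ hist σ t' i := by
  induction t', h using Nat.le_induction with
  | base => exact hb
  | succ t' _ ih =>
    rcases hist_succ_cases σ t' with h | ⟨k, a, -, h⟩
    · rwa [h]
    · rw [h]
      exact History.mem_append.2 (Or.inl ih)

theorem length_hist_mono (i : Fin f) (h : t ≤ t') :
    (hist σ t i).length ≤ (hist σ t' i).length := by
  induction t', h using Nat.le_induction with
  | base => exact le_rfl
  | succ t' _ ih =>
    rcases hist_succ_cases σ t' with h | ⟨k, a, -, h⟩
    · rwa [h]
    · rw [h, History.length_append]
      omega

theorem size_hist_mono (h : t ≤ t') : (hist σ t).size ≤ (hist σ t').size :=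
  Finset.sum_le_sum fun i _ => length_hist_mono i h

/-- Histories only grow, so a history is determined by its size. -/
theorem hist_eq_of_size_le (h : t ≤ t') (hs : (hist σ t').size ≤ (hist σ t).size) :
    hist σ t' = hist σ t := by
  induction t', h using Nat.le_induction with
  | base => rfl
  | succ t' ht ih =>
    have h1 := size_hist_mono (σ := σ) ht
    rcases hist_succ_cases σ t' with h | ⟨k, a, -, h⟩
    · rw [h] at hs ⊢
      exact ih hs
    · rw [h, History.size_append] at hs
      omega

/-- The blocks of a process become more only when the process appends one. -/
theorem exists_appends_of_length_lt (h : t ≤ t')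
    (hlt : (hist σ t k).length < (hist σ t' k).length) :
    ∃ x a, t ≤ x ∧ x < t' ∧ Appends σ x k a := by
  induction t', h using Nat.le_induction with
  | base => omega
  | succ t' ht ih =>
    by_cases h1 : (hist σ t k).length < (hist σ t' k).length
    · obtain ⟨x, a, h2, h3, h4⟩ := ih h1
      exact ⟨x, a, h2, by omega, h4⟩
    · rcases hist_succ_cases σ t' with h | ⟨i, a, ha, h⟩
      · rw [h] at hlt
        omega
      · rw [h, History.length_append] at hlt
        have : k = i := by
          by_contra hne
          rw [if_neg hne] at hlt
          omega
        subst this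
        exact ⟨t', a, ht, by omega, ha⟩

theorem Appends.length_lt (h : Appends σ t k a) :
    (hist σ t k).length < (hist σ (t + 1) k).length := by
  rw [h.hist_succ, History.length_append, if_pos rfl]
  omega

theorem bounded_hist (σ : Schedule f m V) (t : ℕ) : (hist σ t).Bounded := by
  induction t with
  | zero =>
    intro i b hb
    simp [hist, historyOf, reg, Implementation.conf, Implementation.initial,
      helpingSnapshot] at hb
  | succ t ih =>
    rcases hist_succ_cases σ t with h | ⟨k, a, ha, h⟩
    · rwa [h]
    · rw [h]
      intro i b hb l
      rw [History.length_append]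
      rcases History.mem_append.1 hb with hb | ⟨rfl, rfl⟩
      · exact (ih i b hb l).trans (Nat.le_add_right _ _)
      · exact Nat.add_le_add_right (length_hist_mono l ha.2.lt.le) _

/-- A process appends at most one block in each operation. -/
theorem Appends.eq_of_opStart_eq (h : Appends σ t k a) (h' : Appends σ t' k a')
    (hs : opStart σ t k = opStart σ t' k) : t = t' := by
  have key : ∀ {t t' a a'}, Appends σ t k a → Appends σ t' k a' →
      opStart σ t k = opStart σ t' k → ¬ t < t' := by
    intro t t' a a' h h' hs hlt
    have h1 := h.length_lt
    have h2 := length_hist_mono (σ := σ) k (show t + 1 ≤ t' by omega)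
    rw [h.2.hist_eq, hs, ← h'.2.hist_eq] at h1
    omega
  exact le_antisymm (not_lt.1 (key h' h hs.symm)) (not_lt.1 (key h h' hs))

/-- Until its process appends its block, a Block-Update is pending. -/
theorem pending_of_inInterval {s : ℕ}
    (h : (helpingSnapshot f m V).InInterval σ k (.blockUpdate a) s t) (hst : s < t)
    (hlen : (hist σ t k).length = (hist σ s k).length) : Pending σ t k a := by
  obtain ⟨h1, h2⟩ := h.opStart_eq hst
  change opStart σ t k = s at h2
  change loc σ t k ≠ none at h1
  obtain ⟨l, hl⟩ := Option.ne_none_iff_exists'.1 h1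
  have hf := stateFacts hl
  have hb := h.1
  cases l with
  | fresh o => exact hf.elim
  | announceScan H =>
    have h3 := hf.1
    rw [h2] at h3
    cases (h3.eq hb).2
  | recheck c =>
    have h3 := hf.1
    rw [h2] at h3
    cases (h3.eq hb).2
  | append a' H =>
    have h3 := hf.1
    rw [h2] at h3
    cases (h3.eq hb).2
    exact ⟨H, hl⟩
  | collect H =>
    have h3 := hf.2.2
    rw [h2] at h3
    omega
  | announceBlock H =>
    have h3 := hf.2.2.1
    rw [h2] at h3
    omega
  | finish H =>
    have h3 := hf.2.2.1
    rw [h2] at h3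
    omega

/-- The first step of an operation does not complete it. -/
theorem lt_of_completes {s e : ℕ} {o : Op m V} {r : Response m V}
    (h : (helpingSnapshot f m V).Completes σ k o s e r) : s < e := by
  refine h.2.1.lt_of_ne ?_
  rintro rfl
  have hn := (Implementation.loc_succ_eq_none_iff h.1.1).2 ⟨r, h.2.2.1⟩
  have hl : loc σ s k = none := h.1.2
  change loc σ (s + 1) k = none at hn
  cases o with
  | scan => simp [(step_fresh_scan h.1.1 hl).2] at hn
  | blockUpdate a => simp [(step_fresh_block h.1.1 hl).2] at hn

theorem state_of_completes {s e : ℕ} {o : Op m V} {r : Response m V}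
    (h : (helpingSnapshot f m V).Completes σ k o s e r) :
    opStart σ e k = s ∧ ∃ o', σ e = some (k, o') ∧
      ((∃ c, loc σ e k = some (.recheck c) ∧ hist σ e = c ∧ r = .view c.toView) ∨
      ∃ H, loc σ e k = some (.finish H)) := by
  obtain ⟨h1, h2⟩ := h.inInterval.opStart_eq (lt_of_completes h)
  change loc σ e k ≠ none at h1
  refine ⟨h2, ?_⟩
  obtain ⟨o', ho, -⟩ := id h.2.2.1
  refine ⟨o', ho, ?_⟩
  have hn := (Implementation.loc_succ_eq_none_iff ho).2 ⟨r, h.2.2.1⟩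
  change loc σ (e + 1) k = none at hn
  obtain ⟨l, hl⟩ := Option.ne_none_iff_exists'.1 h1
  cases l with
  | fresh o => exact (stateFacts hl).elim
  | announceScan H => simp [(step_announceScan ho hl).2] at hn
  | recheck c =>
    by_cases hc : hist σ e = c
    · exact Or.inl ⟨c, hl, hc, (((step_recheck_eq ho hl hc).2.2 r).1 h.2.2.1).symm⟩
    · simp [(step_recheck_ne ho hl hc).2] at hn
  | append a H => simp [(step_append ho hl).2] at hn
  | collect H => simp [(step_collect ho hl).2] at hn
  | announceBlock H G => simp [(step_announceBlock ho hl).2] at hn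
  | finish H => exact Or.inr ⟨H, hl⟩

/-- At time `t`, process `k` completes a Scan. -/
def ScanEnds (σ : Schedule f m V) (t : ℕ) (k : Fin f) : Prop :=
  (∃ o, σ t = some (k, o)) ∧ loc σ t k = some (.recheck (hist σ t))

theorem completes_scan {s e : ℕ} {r : Response m V}
    (h : (helpingSnapshot f m V).Completes σ k .scan s e r) :
    opStart σ e k = s ∧ ScanEnds σ e k ∧ r = .view (hist σ e).toView := by
  obtain ⟨h1, o', ho, ⟨c, hl, hc, hr⟩ | ⟨H, hl⟩⟩ := state_of_completes h
  · subst hc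
    exact ⟨h1, ⟨⟨o', ho⟩, hl⟩, hr⟩
  · obtain ⟨⟨a, h2⟩, -⟩ := stateFacts hl
    rw [h1] at h2
    cases (h2.eq h.1).2

open Classical in
theorem completes_block {s e : ℕ} {r : Response m V}
    (h : (helpingSnapshot f m V).Completes σ k (.blockUpdate a) s e r) :
    (∃ g, s ≤ g ∧ g < e ∧ (hist σ g k).length = (hist σ s k).length + 1 ∧
      hist σ g ∈ (reg σ e k).log) ∧
    (if ∃ i < k, (hist σ s i).length < (hist σ e i).length then .yield
      else .view (History.latest k (hist σ s) (reg σ e)).toView) = r := by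
  obtain ⟨h1, o', ho, ⟨c, hl, hc, hr⟩ | ⟨H, hl⟩⟩ := state_of_completes h
  · have h2 := (stateFacts hl).1
    rw [h1] at h2
    cases (h2.eq h.1).2
  · obtain ⟨-, h3, h4, h5⟩ := stateFacts hl
    rw [h1] at h3 h5
    subst h3
    exact ⟨h5, ((step_finish ho hl).2.2 r).1 h.2.2.1⟩

/-- A completed Block-Update has appended its block. -/
theorem exists_appends_of_completes {s e : ℕ} {r : Response m V}
    (h : (helpingSnapshot f m V).Completes σ k (.blockUpdate a) s e r) :
    ∃ x, s < x ∧ x < e ∧ Appends σ x k a ∧ opStart σ x k = s := by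
  obtain ⟨⟨g, h1, h2, h3, -⟩, -⟩ := completes_block h
  obtain ⟨x, a', h4, h5, h6⟩ := exists_appends_of_length_lt h1 (by omega : _ < (hist σ g k).length)
  have hne : s ≠ x := by
    rintro rfl
    obtain ⟨H, hl⟩ := h6.2
    have : loc σ s k = none := h.1.2
    rw [hl] at this
    cases this
  have h7 := ((h.inInterval.mono h4 (by omega)).opStart_eq (by omega)).2
  change opStart σ x k = s at h7
  have h8 := h6.2.begins
  rw [h7] at h8
  cases (h8.eq h.1).2
  exact ⟨x, by omega, by omega, h6, h7⟩

theorem ScanEnds.begins (h : ScanEnds σ t k) :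
    (helpingSnapshot f m V).Begins σ (opStart σ t k) k .scan := (stateFacts h.2).1

theorem ScanEnds.mem_log (h : ScanEnds σ t k) : hist σ t ∈ (reg σ t k).log := (stateFacts h.2).2

theorem ScanEnds.inInterval (h : ScanEnds σ t k) :
    (helpingSnapshot f m V).InInterval σ k .scan (opStart σ t k) t := by
  refine Implementation.inInterval_opStart ?_ h.begins
  change loc σ t k ≠ none
  simp [h.2]

/-! ### The linearization -/

/-- The pairs (component, value) of the block that process `k` is about to append, if any. -/
noncomputable def pendingPairs (σ : Schedule f m V) (t : ℕ) (k : Fin f) : List (Fin m × V) :=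
  match loc σ t k with
  | some (.append a _) => a.pairs
  | _ => []

open Classical in
/-- The Updates of the Block-Update pending at process `k`, of components satisfying `P`, that are
not covered by a block with a larger timestamp. -/
noncomputable def uncoveredUpdates (σ : Schedule f m V) (t : ℕ) (k : Fin f) (P : Fin m → Prop) :
    List (Event m V) :=
  ((pendingPairs σ t k).filter fun p => P p.1 ∧ (hist σ t).Uncovered p.1 (stamp σ t k)).map
    fun p => Event.update (opStart σ t k) p.1 p.2

open Classical in
/-- The Updates of pending Block-Updates that get covered if process `i` appends its block at
time `t`. -/
noncomputable def overtakenUpdates (σ : Schedule f m V) (t : ℕ) (i : Fin f) : List (Event m V) :=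
  ((List.finRange f).flatMap fun k => uncoveredUpdates σ t k fun j =>
    stamp σ t k < stamp σ t i ∧ ∃ v, (j, v) ∈ pendingPairs σ t i).dedup

open Classical in
/-- The Updates that take effect in `H` if process `i` appends its block at time `t`. -/
noncomputable def ownUpdates (σ : Schedule f m V) (t : ℕ) (i : Fin f) : List (Event m V) :=
  (uncoveredUpdates σ t i fun _ => True).dedup

open Classical in
/-- The events that are linearized at time `t`: a Scan at its last step; and when a block is
appended, the pending Updates that it covers, followed by those of its own that are not covered
yet. -/
noncomputable def batch (σ : Schedule f m V) (t : ℕ) : List (Event m V) :=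
  match σ t with
  | none => []
  | some (i, _) =>
    if ScanEnds σ t i then [Event.scan (opStart σ t i)]
    else if ∃ a, Pending σ t i a then overtakenUpdates σ t i ++ ownUpdates σ t i
    else []

theorem mem_pendingPairs {p : Fin m × V} :
    p ∈ pendingPairs σ t k ↔ ∃ a, Pending σ t k a ∧ p ∈ a.pairs := by
  unfold pendingPairs Pending
  constructor
  · intro h
    split at h
    · rename_i a H hl
      exact ⟨a, ⟨H, hl⟩, h⟩
    · simp at h
  · rintro ⟨a, ⟨H, hl⟩, h⟩
    rw [hl]
    exact h

theorem mem_uncoveredUpdates {P : Fin m → Prop} {x : Event m V} :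
    x ∈ uncoveredUpdates σ t k P ↔ ∃ a j v, Pending σ t k a ∧ (j, v) ∈ a.pairs ∧ P j ∧
      (hist σ t).Uncovered j (stamp σ t k) ∧ x = Event.update (opStart σ t k) j v := by
  simp only [uncoveredUpdates, List.mem_map, List.mem_filter, mem_pendingPairs, decide_eq_true_eq,
    Prod.exists]
  constructor
  · rintro ⟨j, v, ⟨⟨a, h1, h2⟩, h3, h4⟩, rfl⟩
    exact ⟨a, j, v, h1, h2, h3, h4, rfl⟩
  · rintro ⟨a, j, v, h1, h2, h3, h4, rfl⟩
    exact ⟨j, v, ⟨⟨a, h1, h2⟩, h3, h4⟩, rfl⟩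

theorem mem_ownUpdates {x : Event m V} : x ∈ ownUpdates σ t k ↔ ∃ a j v, Pending σ t k a ∧
    (j, v) ∈ a.pairs ∧ (hist σ t).Uncovered j (stamp σ t k) ∧
      x = Event.update (opStart σ t k) j v := by
  simp [ownUpdates, mem_uncoveredUpdates]

theorem mem_overtakenUpdates {i : Fin f} {x : Event m V} : x ∈ overtakenUpdates σ t i ↔
    ∃ k a j v, Pending σ t k a ∧ (j, v) ∈ a.pairs ∧
      (stamp σ t k < stamp σ t i ∧ ∃ b v', Pending σ t i b ∧ (j, v') ∈ b.pairs) ∧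
      (hist σ t).Uncovered j (stamp σ t k) ∧ x = Event.update (opStart σ t k) j v := by
  simp only [overtakenUpdates, List.mem_dedup, List.mem_flatMap, List.mem_finRange, true_and,
    mem_uncoveredUpdates, mem_pendingPairs]
  constructor
  · rintro ⟨k, a, j, v, h1, h2, ⟨h3, v', b, h4, h5⟩, h6, rfl⟩
    exact ⟨k, a, j, v, h1, h2, ⟨h3, b, v', h4, h5⟩, h6, rfl⟩
  · rintro ⟨k, a, j, v, h1, h2, ⟨h3, b, v', h4, h5⟩, h6, rfl⟩
    exact ⟨k, a, j, v, h1, h2, ⟨h3, v', b, h4, h5⟩, h6, rfl⟩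

theorem batch_of_scanEnds (h : ScanEnds σ t k) : batch σ t = [Event.scan (opStart σ t k)] := by
  obtain ⟨o, ho⟩ := h.1
  simp [batch, ho, h]

theorem batch_of_appends (h : Appends σ t k a) :
    batch σ t = overtakenUpdates σ t k ++ ownUpdates σ t k := by
  obtain ⟨⟨o, ho⟩, ha⟩ := h
  have hs : ¬ ScanEnds σ t k := by
    rintro ⟨-, hl⟩
    obtain ⟨H, hl'⟩ := ha
    rw [hl] at hl'
    cases hl'
  have hex : ∃ a, Pending σ t k a := ⟨a, ha⟩
  simp [batch, ho, hs, hex]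

theorem batch_cases (σ : Schedule f m V) (t : ℕ) :
    (∃ k, ScanEnds σ t k) ∨ (∃ k a, Appends σ t k a) ∨ batch σ t = [] := by
  rcases ho : σ t with _ | ⟨i, o⟩
  · exact Or.inr (Or.inr (by simp [batch, ho]))
  · by_cases h1 : ScanEnds σ t i
    · exact Or.inl ⟨i, h1⟩
    · by_cases h2 : ∃ a, Pending σ t i a
      · obtain ⟨a, h2⟩ := h2
        exact Or.inr (Or.inl ⟨i, a, ⟨o, ho⟩, h2⟩)
      · exact Or.inr (Or.inr (by simp [batch, ho, h1, h2]))

theorem mem_batch_scan {s : ℕ} (h : Event.scan s ∈ batch σ t) :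
    ∃ k, ScanEnds σ t k ∧ s = opStart σ t k := by
  rcases batch_cases σ t with ⟨k, hk⟩ | ⟨k, a, hk⟩ | hn
  · rw [batch_of_scanEnds hk] at h
    exact ⟨k, hk, by simpa using h⟩
  · rw [batch_of_appends hk] at h
    simp [mem_overtakenUpdates, mem_ownUpdates] at h
  · simp [hn] at h

theorem not_mem_overtakenUpdates_self (h : Pending σ t k a) (j : Fin m) (v : V) :
    Event.update (opStart σ t k) j v ∉ overtakenUpdates σ t k := by
  intro hm
  obtain ⟨k', a', j', v', h1, -, ⟨h2, -⟩, -, h3⟩ := mem_overtakenUpdates.1 hm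
  have hb := h.begins
  rw [(Event.update.inj h3).1] at hb
  obtain rfl := (hb.eq h1.begins).1
  exact lt_irrefl _ h2

/-- An Update is linearized when it gets covered, that is, when the first block is appended that
has the same component and a timestamp at least as large. -/
theorem mem_batch_update {s : ℕ} {j : Fin m} {v : V} (h : Event.update s j v ∈ batch σ t) :
    ∃ k a, Pending σ t k a ∧ s = opStart σ t k ∧ (j, v) ∈ a.pairs ∧
      (hist σ t).Uncovered j (stamp σ t k) ∧
      ¬ (hist σ (t + 1)).Uncovered j (stamp σ t k) := by
  have hnot : ∀ {k i : Fin f} {b : BlockArg m V} {v' : V}, Appends σ t i b →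
      (j, v') ∈ b.pairs → stamp σ t k ≤ stamp σ t i →
      ¬ (hist σ (t + 1)).Uncovered j (stamp σ t k) := by
    intro k i b v' hi hj hle hu
    refine not_lt.2 hle (hu i ⟨b, stamp σ t i⟩ ?_ ⟨v', hj⟩)
    rw [hi.hist_succ]
    exact History.mem_append.2 (Or.inr ⟨rfl, rfl⟩)
  rcases batch_cases σ t with ⟨k, hk⟩ | ⟨i, b, hi⟩ | hn
  · simp [batch_of_scanEnds hk] at h
  · rw [batch_of_appends hi, List.mem_append] at h
    rcases h with h | h
    · obtain ⟨k, a, j', v', h1, h2, ⟨h3, b', v'', h6, h7⟩, h4, h5⟩ := mem_overtakenUpdates.1 h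
      cases h5
      rw [h6.arg_eq hi.2] at h7
      exact ⟨k, a, h1, rfl, h2, h4, hnot hi h7 h3.le⟩
    · obtain ⟨a, j', v', h1, h2, h4, h5⟩ := mem_ownUpdates.1 h
      cases h5
      refine ⟨i, a, h1, rfl, h2, h4, ?_⟩
      rw [h1.arg_eq hi.2] at h2
      exact hnot hi h2 le_rfl
  · simp [hn] at h

theorem stamp_eq_of_opStart_eq (h : opStart σ t k = opStart σ t' k) :
    stamp σ t k = stamp σ t' k := by
  rw [stamp, h, stamp]

theorem uncovered_anti {j : Fin m} {x : Lex (Fin f → ℕ)} (h : t ≤ t')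
    (hu : (hist σ t').Uncovered j x) : (hist σ t).Uncovered j x :=
  fun i b hb => hu i b (mem_hist_mono h hb)

theorem nodup_batch (σ : Schedule f m V) (t : ℕ) : (batch σ t).Nodup := by
  classical
  rcases batch_cases σ t with ⟨k, hk⟩ | ⟨i, b, hi⟩ | hn
  · simp [batch_of_scanEnds hk]
  · rw [batch_of_appends hi]
    refine List.nodup_append.2 ⟨List.nodup_dedup _, List.nodup_dedup _, ?_⟩
    rintro x hx y hy rfl
    obtain ⟨a, j, v, h1, -, -, rfl⟩ := mem_ownUpdates.1 hy
    exact not_mem_overtakenUpdates_self h1 j v hx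
  · simp [hn]

theorem batch_disjoint {x : Event m V} (h : x ∈ batch σ t) (h' : x ∈ batch σ t') : t = t' := by
  have key : ∀ {t t'}, x ∈ batch σ t → x ∈ batch σ t' → ¬ t < t' := by
    intro t t' h h' hlt
    cases x with
    | scan s =>
      obtain ⟨k, hk, rfl⟩ := mem_batch_scan h
      obtain ⟨k', hk', hs⟩ := mem_batch_scan h'
      have hb := hk.begins
      rw [hs] at hb
      obtain rfl := (hb.eq hk'.begins).1
      obtain ⟨⟨o, ho⟩, hl⟩ := hk
      have hr := ((step_recheck_eq ho hl rfl).2.2 _).2 rfl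
      exact (Implementation.inInterval_iff.1 hk'.inInterval).2.2 t
        (by rw [← hs]; exact (opStart_lt hl).le) hlt _ hr
    | update s j v =>
      obtain ⟨k, a, h1, h2, -, -, h3⟩ := mem_batch_update h
      obtain ⟨k', a', h1', h2', -, h3', -⟩ := mem_batch_update h'
      have hs := h2.symm.trans h2'
      have hb := h1.begins
      rw [hs] at hb
      obtain rfl := (hb.eq h1'.begins).1
      rw [stamp_eq_of_opStart_eq hs] at h3
      exact h3 (uncovered_anti hlt h3')
  exact le_antisymm (not_lt.1 (key h' h)) (not_lt.1 (key h h'))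

/-- The contents of the augmented snapshot in the linearization are those given by `H`. -/
theorem contentsAt_batch (σ : Schedule f m V) (t : ℕ) :
    EventSeq.contentsAt (batch σ) t = (hist σ t).toView := by
  induction t with
  | zero =>
    ext1 j
    have : ¬ ∃ v, (hist σ 0).IsLastValue j v := by
      rintro ⟨v, i, b, hb, -⟩
      simp [hist, historyOf, reg, Implementation.conf, Implementation.initial,
        helpingSnapshot] at hb
    rw [History.toView, dif_neg this]
    rfl
  | succ t ih =>
    rw [EventSeq.contentsAt, ih]
    by_cases happ : ∃ i b, Appends σ t i b
    · obtain ⟨i, b, hi⟩ := happ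
      rw [batch_of_appends hi, hi.hist_succ, List.foldl_append]
      ext1 j
      by_cases hj : (∃ v, (j, v) ∈ b.pairs) ∧ (hist σ t).Uncovered j (stamp σ t i)
      · obtain ⟨⟨v, hv⟩, hu⟩ := hj
        rw [History.toView_append_of_uncovered hv hu]
        apply EventSeq.foldl_apply_of_mem
        · intro s v' h
          obtain ⟨a, j', v'', h1, h2, -, h3⟩ := mem_ownUpdates.1 h
          cases h3
          rw [h1.arg_eq hi.2] at h2
          exact BlockArg.value_unique h2 hv
        · exact ⟨_, mem_ownUpdates.2 ⟨b, j, v, hi.2, hv, hu, rfl⟩⟩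
      · rw [not_and] at hj
        rw [History.toView_append_of_covered hj]
        · rw [EventSeq.foldl_apply_of_forall_ne, EventSeq.foldl_apply_of_forall_ne]
          · intro s v h
            obtain ⟨k, a, j', v', -, -, ⟨h1, b', v'', h2, h3⟩, h4, h5⟩ := mem_overtakenUpdates.1 h
            cases h5
            rw [h2.arg_eq hi.2] at h3
            -- an update that is overtaken but not covered leaves the own one uncovered
            exact hj ⟨v'', h3⟩ fun i' b' hb' hj' => (h4 i' b' hb' hj').trans h1
          · intro s v h
            obtain ⟨a, j', v', h1, h2, h3, h4⟩ := mem_ownUpdates.1 h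
            cases h4
            rw [h1.arg_eq hi.2] at h2
            exact hj ⟨v, h2⟩ h3
        · intro l b' hb'
          exact (bounded_hist σ t).stamp_ne_nextStamp (by rw [hi.2.hist_eq]) hb'
    · push Not at happ
      rw [hist_succ_of_not_appends happ]
      rcases batch_cases σ t with ⟨k, hk⟩ | ⟨i, b, hi⟩ | hn
      · rw [batch_of_scanEnds hk]
        rfl
      · exact absurd hi (happ i b)
      · rw [hn]
        rfl

/-- Every Update of a completed Block-Update is linearized. -/
theorem exists_update_mem_batch {s e : ℕ} {r : Response m V}
    (h : (helpingSnapshot f m V).Completes σ k (.blockUpdate a) s e r) {j : Fin m} {v : V}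
    (hv : (j, v) ∈ a.pairs) : ∃ t, Event.update s j v ∈ batch σ t := by
  obtain ⟨x, hsx, hxe, hx, hxs⟩ := exists_appends_of_completes h
  have hlen : ∀ y, s ≤ y → y ≤ x → (hist σ y k).length = (hist σ s k).length := by
    intro y h1 h2
    have h3 := length_hist_mono (σ := σ) k h1
    have h4 := length_hist_mono (σ := σ) k h2
    rw [hx.2.hist_eq, hxs] at h4
    omega
  by_cases hu : (hist σ x).Uncovered j (stamp σ x k)
  · refine ⟨x, ?_⟩
    rw [batch_of_appends hx, List.mem_append]
    exact Or.inr (mem_ownUpdates.2 ⟨a, j, v, hx.2, hv, hu, by rw [hxs]⟩)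
  · -- the step at which the Update gets covered
    have hstep : ∃ y, s ≤ y ∧ y < x ∧ (hist σ y).Uncovered j (stamp σ x k) ∧
        ¬ (hist σ (y + 1)).Uncovered j (stamp σ x k) := by
      by_contra hno
      push Not at hno
      refine hu (Nat.le_induction (P := fun y _ => y ≤ x → (hist σ y).Uncovered j (stamp σ x k))
        (fun _ => ?_) (fun y hy ih hyx => ?_) x hsx.le le_rfl)
      · intro i b hb _
        rw [stamp, hxs]
        exact (bounded_hist σ s).lt_nextStamp rfl (fun _ _ => rfl) hb
      · exact hno y hy (by omega) (ih (by omega))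
    obtain ⟨y, h1, h2, h3, h4⟩ := hstep
    rcases hist_succ_cases σ y with h5 | ⟨i, b, hi, h5⟩
    · rw [h5] at h4
      exact absurd h3 h4
    · have hsy : s ≠ y := by
        rintro rfl
        obtain ⟨⟨o', ho'⟩, H, hl⟩ := hi
        have hik : i = k := congrArg Prod.fst (Option.some.inj (ho'.symm.trans h.1.1))
        rw [hik, show loc σ s k = none from h.1.2] at hl
        cases hl
      have hin := h.inInterval.mono h1 (by omega)
      have hp := pending_of_inInterval hin (by omega) (hlen y h1 h2.le)
      have hys : opStart σ y k = s := (hin.opStart_eq (by omega)).2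
      have hst : stamp σ y k = stamp σ x k := stamp_eq_of_opStart_eq (hys.trans hxs.symm)
      refine ⟨y, ?_⟩
      rw [batch_of_appends hi, List.mem_append]
      refine Or.inl (mem_overtakenUpdates.2 ⟨k, a, j, v, hp, hv, ?_, by rw [hst]; exact h3,
        by rw [hys]⟩)
      have hcov : (∃ v', (j, v') ∈ b.pairs) ∧ stamp σ x k ≤ stamp σ y i := by
        by_contra hno
        refine h4 fun l b' hb' hj => ?_
        rw [h5] at hb'
        rcases History.mem_append.1 hb' with hb' | ⟨-, rfl⟩
        · exact h3 l b' hb' hj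
        · exact not_le.1 fun hle => hno ⟨hj, hle⟩
      obtain ⟨⟨v', hv'⟩, hle⟩ := hcov
      refine ⟨(hst ▸ hle).lt_of_ne fun heq => ?_, b, v', hi.2, hv'⟩
      -- `i` is not `k`, which appends its block only at time `x`; so the timestamp of `k` does not
      -- count the block that `i` is appending, whereas the timestamp of this block does
      have hne : i ≠ k := by
        rintro rfl
        exact h2.ne (hi.eq_of_opStart_eq hx (hys.trans hxs.symm))
      have heq' := congrFun (congrArg ofLex heq) i
      have h6 := length_hist_mono (σ := σ) i h1
      rw [hi.2.hist_eq] at h6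
      simp [stamp, History.nextStamp, hys, hne] at heq'
      omega

theorem completes_view {s e : ℕ} {w : View m V}
    (h : (helpingSnapshot f m V).Completes σ k (.blockUpdate a) s e (.view w)) :
    (∀ l < k, (hist σ e l).length ≤ (hist σ s l).length) ∧
      w = (History.latest k (hist σ s) (reg σ e)).toView := by
  have := (completes_block h).2
  split_ifs at this with h1
  push Not at h1
  cases this
  exact ⟨h1, rfl⟩

/-- The block of an atomic Block-Update has the largest timestamp when it is appended. -/
theorem uncovered_of_completes_view {s e x : ℕ} {w : View m V}
    (h : (helpingSnapshot f m V).Completes σ k (.blockUpdate a) s e (.view w))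
    (hx : Appends σ x k a') (hxs : opStart σ x k = s) (hxe : x ≤ e) (j : Fin m) :
    (hist σ x).Uncovered j (stamp σ x k) := by
  intro i b hb _
  have hsx : s ≤ x := hxs ▸ hx.2.lt.le
  refine (bounded_hist σ x).lt_nextStamp (by rw [hx.2.hist_eq]) (fun l hl => ?_) hb
  have h1 := (completes_view h).1 l hl
  have h2 := length_hist_mono (σ := σ) l hxe
  have h3 := length_hist_mono (σ := σ) l hsx
  rw [hxs]
  omega

/-- The Updates of an atomic Block-Update are linearized when its block is appended. -/
theorem atomic_mem_batch {s : ℕ} {j : Fin m} {v : V} (hs : (helpingSnapshot f m V).Atomic σ s)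
    (h : Event.update s j v ∈ batch σ t) :
    ∃ k a e w, (helpingSnapshot f m V).Completes σ k (.blockUpdate a) s e (.view w) ∧
      Appends σ t k a ∧ opStart σ t k = s ∧ t < e := by
  obtain ⟨k, a, e, w, hc⟩ := hs
  obtain ⟨x, hsx, hxe, hx, hxs⟩ := exists_appends_of_completes hc
  obtain ⟨k', a', h1, h2, -, -, h3⟩ := mem_batch_update h
  have hb := h1.begins
  rw [← h2] at hb
  obtain rfl := (hb.eq hc.1).1
  have hle : t ≤ x := by
    by_contra hlt
    have h4 := hx.length_lt
    have h5 := length_hist_mono (σ := σ) k' (show x + 1 ≤ t by omega)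
    rw [h1.hist_eq, ← h2, ← hxs, ← hx.2.hist_eq] at h5
    omega
  rcases hle.lt_or_eq with hlt | rfl
  · refine absurd (uncovered_anti (show t + 1 ≤ x from hlt) ?_) h3
    rw [stamp_eq_of_opStart_eq (h2.symm.trans hxs.symm)]
    exact uncovered_of_completes_view hc hx hxs hxe.le j
  · exact ⟨k', a, e, w, hc, hx, hxs, hxe⟩

theorem isLinearization (σ : Schedule f m V) :
    (helpingSnapshot f m V).IsLinearization σ (EventSeq.ofBatches (batch σ)) where
  mono := EventSeq.cursor_fst_mono
  once _ _ _ := EventSeq.ofBatches_once (nodup_batch σ) fun _ _ _ => batch_disjoint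
  scan_mem p s h := by
    obtain ⟨k, hk, rfl⟩ := mem_batch_scan (EventSeq.mem_of_event h)
    exact ⟨k, hk.inInterval⟩
  update_mem p s j v h := by
    obtain ⟨k, a, hk, rfl, hv, -⟩ := mem_batch_update (EventSeq.mem_of_event h)
    exact ⟨k, a, hv, hk.inInterval⟩
  scan_complete k s e r h := by
    obtain ⟨hs, he, rfl⟩ := completes_scan h
    have hb := batch_of_scanEnds he
    rw [hs] at hb
    obtain ⟨p, hp, hpe⟩ := EventSeq.exists_event_of_mem (E := batch σ) (t := e)
      (x := Event.scan s) (by simp [hb])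
    refine ⟨p, hp, ?_⟩
    have h0 : (EventSeq.cursor (batch σ) p).2 = 0 := by
      have := (List.getElem?_eq_some_iff.1 hp).1
      rw [hpe, hb] at this
      simpa using this
    rw [EventSeq.contents_ofBatches, h0, hpe, contentsAt_batch]
    rfl
  update_complete k a s e r h j v hv := by
    obtain ⟨t, ht⟩ := exists_update_mem_batch h hv
    obtain ⟨p, hp, -⟩ := EventSeq.exists_event_of_mem ht
    exact ⟨p, hp⟩

/-- In the batch of the step that appends a block, the Updates of its operation come last. -/
theorem length_overtakenUpdates_le {p : ℕ} {j : Fin m} {v : V}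
    (hp : (EventSeq.ofBatches (batch σ)).event p = some (Event.update (opStart σ t k) j v))
    (ht : (EventSeq.cursor (batch σ) p).1 = t) (h : Appends σ t k a) :
    (overtakenUpdates σ t k).length ≤ (EventSeq.cursor (batch σ) p).2 := by
  by_contra hlt
  rw [not_le] at hlt
  have hp' : (batch σ (EventSeq.cursor (batch σ) p).1)[(EventSeq.cursor (batch σ) p).2]? =
      some (Event.update (opStart σ t k) j v) := hp
  rw [ht, batch_of_appends h, List.getElem?_append_left hlt] at hp'
  exact not_mem_overtakenUpdates_self h.2 j v (List.mem_of_getElem? hp')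

theorem atomicConsecutive (σ : Schedule f m V) :
    (helpingSnapshot f m V).AtomicConsecutive σ (EventSeq.ofBatches (batch σ)) := by
  intro s hs p q p' j v j' v' hp hp' hpq hqp x hx
  obtain ⟨k, a, e, w, hc, hk, hks, -⟩ := atomic_mem_batch hs (EventSeq.mem_of_event hp)
  obtain ⟨k', a', e', w', hc', hk', hks', -⟩ := atomic_mem_batch hs (EventSeq.mem_of_event hp')
  obtain rfl := (hc.1.eq hc'.1).1
  have ht := hk.eq_of_opStart_eq hk' (hks.trans hks'.symm)
  have h1 := EventSeq.cursor_fst_mono (E := batch σ) hpq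
  have h2 := EventSeq.cursor_fst_mono (E := batch σ) hqp
  simp only at h1 h2
  have hq : (EventSeq.cursor (batch σ) q).1 = (EventSeq.cursor (batch σ) p).1 := by omega
  have hle : (EventSeq.cursor (batch σ) p).2 ≤ (EventSeq.cursor (batch σ) q).2 := by
    rcases hpq.lt_or_eq with h | rfl
    · have := EventSeq.cursor_lt (E := batch σ) h
      omega
    · exact le_rfl
  have hlen := length_overtakenUpdates_le (by rw [hks]; exact hp) rfl hk
  have hx' : (batch σ (EventSeq.cursor (batch σ) q).1)[(EventSeq.cursor (batch σ) q).2]? =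
      some x := hx
  rw [hq, batch_of_appends hk, List.getElem?_append_right (hlen.trans hle)] at hx'
  obtain ⟨-, j'', v'', -, -, -, rfl⟩ := mem_ownUpdates.1 (List.mem_of_getElem? hx')
  exact ⟨j'', v'', by rw [hks]⟩

theorem ScanEnds.hist_succ (h : ScanEnds σ t k) : hist σ (t + 1) = hist σ t := by
  obtain ⟨⟨o, ho⟩, hl⟩ := h
  rw [hist, (step_recheck_eq ho hl rfl).1, hist]

/-- The view that an atomic Block-Update returns is that of a history, and from the last time `T`
with this history to the time `x` at which the block is appended, no Scan is completed and no
block of another atomic Block-Update is appended. -/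
theorem exists_latest_time {s e x : ℕ} {w : View m V}
    (h : (helpingSnapshot f m V).Completes σ k (.blockUpdate a) s e (.view w))
    (hx : Appends σ x k a') (hxs : opStart σ x k = s) (hxe : x < e) :
    ∃ T ≤ x, w = (hist σ T).toView ∧
      (∀ y, T ≤ y → y < x → ∀ i, ¬ ScanEnds σ y i) ∧
      ∀ y, T ≤ y → y < x → ∀ i b s' e' w', Appends σ y i b → opStart σ y i = s' →
        ¬ (helpingSnapshot f m V).Completes σ i (.blockUpdate b) s' e' (.view w') := by
  classical
  obtain ⟨hlow, rfl⟩ := completes_view h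
  set best := History.latest k (hist σ s) (reg σ e) with hbest
  have hsx : s < x := hxs ▸ hx.2.lt
  have hlen : ∀ y, s ≤ y → y ≤ x → (hist σ y k).length = (hist σ s k).length := by
    intro y h1 h2
    have h3 := length_hist_mono (σ := σ) k h1
    have h4 := length_hist_mono (σ := σ) k h2
    rw [hx.2.hist_eq, hxs] at h4
    omega
  have hg : ∃ g ≤ x, hist σ g = best := by
    rcases History.mem_candidates.1 (History.latest_mem k (hist σ s) (reg σ e)) with
      h1 | ⟨⟨i, h1⟩, h2⟩
    · exact ⟨s, hsx.le, h1.symm⟩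
    · obtain ⟨g, -, hg⟩ := exists_hist_of_mem_log h1
      refine ⟨g, ?_, hg⟩
      by_contra hlt
      have h3 := hx.length_lt
      have h4 := length_hist_mono (σ := σ) k (show x + 1 ≤ g by omega)
      have h5 := hlen x hsx.le le_rfl
      rw [← hg] at h2
      omega
  obtain ⟨g, hgx, hg⟩ := hg
  set T := Nat.findGreatest (fun y => hist σ y = best) x with hT
  have hTbest : hist σ T = best := Nat.findGreatest_spec (P := fun y => hist σ y = best) hgx hg
  have hTx : T ≤ x := Nat.findGreatest_le x
  have hmax : ∀ y ≤ x, hist σ y = best → y ≤ T := fun y h1 h2 => Nat.le_findGreatest h1 h2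
  have hcand : ∀ y ≤ x, hist σ y ∈ History.candidates k (hist σ s) (reg σ e) → T ≤ y →
      hist σ y = best := by
    intro y h1 h2 h3
    rw [← hTbest]
    refine hist_eq_of_size_le h3 ?_
    rw [hTbest]
    exact History.size_le_size_latest h2
  have hsT : s ≤ T := by
    by_contra hlt
    have := hmax s hsx.le
      (hcand s hsx.le (History.mem_candidates.2 (Or.inl rfl)) (by omega))
    omega
  have hlog : ∀ y, T ≤ y → y ≤ x → ∀ i, ∀ e' ≤ e, hist σ y ∈ (reg σ e' i).log →
      hist σ y = best := by
    intro y h1 h2 i e' h3 h4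
    refine hcand y h2 (History.mem_candidates.2 (Or.inr ⟨⟨i, log_mono i h3 h4⟩, ?_⟩)) h1
    exact hlen y (by omega) h2
  refine ⟨T, hTx, by rw [hTbest], ?_, ?_⟩
  · intro y h1 h2 i hi
    have h3 := hlog y h1 h2.le i y (by omega) hi.mem_log
    have := hmax (y + 1) h2 (hi.hist_succ.trans h3)
    omega
  · intro y h1 h2 i b s' e' w' hi hs' hc
    obtain ⟨⟨g', h3, h4, h5, h6⟩, -⟩ := completes_block hc
    have h7 := hi.length_lt
    have hyg : y < g' := by
      by_contra hle
      have h8 := length_hist_mono (σ := σ) i (not_lt.1 hle)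
      rw [hi.2.hist_eq, hs'] at h8
      omega
    rcases lt_trichotomy i k with hik | rfl | hik
    · -- `k` would have yielded to `i`
      have h8 := hlow i hik
      have h9 := length_hist_mono (σ := σ) i (hsT.trans h1)
      have h10 := length_hist_mono (σ := σ) i (show y + 1 ≤ e by omega)
      omega
    · have h8 := hlen y (by omega) h2.le
      have h9 := hlen (y + 1) (by omega) h2
      omega
    · -- `i` would have yielded to `k`, unless its operation is completed before `x`, so that
      -- its announcement was seen by `k`
      have hex : e' ≤ x := by
        by_contra hlt
        have h8 := (completes_view hc).1 k hik
        have h9 := length_hist_mono (σ := σ) k (show s' ≤ x from hs' ▸ hi.2.lt.le.trans h2.le)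
        have h10 := length_hist_mono (σ := σ) k (show x + 1 ≤ e' by omega)
        have h11 := hx.length_lt
        omega
      have := hmax g' (by omega) (hlog g' (by omega) (by omega) i e' (by omega) h6)
      omega

theorem atomicReturnsEarlierView (σ : Schedule f m V) :
    (helpingSnapshot f m V).AtomicReturnsEarlierView σ (EventSeq.ofBatches (batch σ)) := by
  intro k a s e w hc
  obtain ⟨x, hsx, hxe, hx, hxs⟩ := exists_appends_of_completes hc
  obtain ⟨T₀, hT₀, hw, hscan, hblock⟩ := exists_latest_time hc hx hxs hxe
  obtain ⟨T, hT⟩ := EventSeq.exists_cursor_eq (E := batch σ) (t := T₀) (Nat.zero_le _)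
  have hbx := batch_of_appends hx
  obtain ⟨Z, hZ⟩ := EventSeq.exists_cursor_eq (E := batch σ) (t := x)
    (r := (overtakenUpdates σ x k).length) (by rw [hbx]; simp)
  have hatomic : (helpingSnapshot f m V).Atomic σ s := ⟨k, a, e, w, hc⟩
  refine ⟨T, Z, ?_, ?_, ?_, ?_, ?_⟩
  · by_contra hlt
    have := EventSeq.cursor_lt (E := batch σ) (not_le.1 hlt)
    rw [hT, hZ] at this
    simp only at this
    omega
  · have hne : ownUpdates σ x k ≠ [] := by
      obtain ⟨⟨j, v⟩, hv⟩ := List.exists_mem_of_ne_nil _ a.nonempty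
      exact List.ne_nil_of_mem (mem_ownUpdates.2 ⟨a, j, v, hx.2, hv,
        uncovered_of_completes_view hc hx hxs hxe.le j, rfl⟩)
    obtain ⟨y, L, hL⟩ := List.exists_cons_of_ne_nil hne
    have hy : y ∈ ownUpdates σ x k := by simp [hL]
    obtain ⟨-, j, v, -, -, -, rfl⟩ := mem_ownUpdates.1 hy
    refine ⟨j, v, ?_⟩
    change (batch σ (EventSeq.cursor (batch σ) Z).1)[(EventSeq.cursor (batch σ) Z).2]? = _
    rw [hZ, hbx, List.getElem?_append_right le_rfl, hL, hxs]
    simp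
  · intro p j v hp
    obtain ⟨k', a', _, _, hc', hk', hks', -⟩ :=
      atomic_mem_batch hatomic (EventSeq.mem_of_event hp)
    obtain rfl := (hc.1.eq hc'.1).1
    have ht := hk'.eq_of_opStart_eq hx (hks'.trans hxs.symm)
    have hlen := length_overtakenUpdates_le (by rw [hxs]; exact hp) ht hx
    by_contra hlt
    have := EventSeq.cursor_lt (E := batch σ) (not_le.1 hlt)
    rw [hZ] at this
    simp only at this
    omega
  · rw [EventSeq.contents_ofBatches, hT, contentsAt_batch]
    exact hw
  · intro p hTp hpZ
    have hTy : T₀ ≤ (EventSeq.cursor (batch σ) p).1 := by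
      have := EventSeq.cursor_fst_mono (E := batch σ) hTp
      simpa only [hT] using this
    have hyx := EventSeq.cursor_lt (E := batch σ) hpZ
    rw [hZ] at hyx
    simp only at hyx
    constructor
    · intro s' hp
      obtain ⟨i, hi, -⟩ := mem_batch_scan (EventSeq.mem_of_event hp)
      rcases hyx with hyx | ⟨hyx, -⟩
      · exact hscan _ hTy hyx i hi
      · have hm := EventSeq.mem_of_event hp
        rw [hyx, hbx] at hm
        simp [mem_overtakenUpdates, mem_ownUpdates] at hm
    · intro s' j v hp hs'
      obtain ⟨i, b, e', w', hc', hi, his, -⟩ := atomic_mem_batch hs' (EventSeq.mem_of_event hp)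
      rcases hyx with hyx | ⟨hyx, hlt⟩
      · exact hblock _ hTy hyx i b s' e' w' hi his hc'
      · rw [hyx] at hi his
        obtain rfl := hi.proc_eq hx
        have := length_overtakenUpdates_le (by rw [his]; exact hp) hyx hx
        omega

theorem isAugmentedSnapshot : (helpingSnapshot f m V).IsAugmentedSnapshot := fun σ =>
  ⟨_, isLinearization σ, atomicConsecutive σ, atomicReturnsEarlierView σ⟩

/-! ### Progress -/

/-- An operation is not blocked if each later step of its process lowers the rank of its local
state. -/
theorem not_blocked_of_rank {s N : ℕ} {o : Op m V} (rank : Option (LocalState f m V) → ℕ)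
    (h : ∀ t, N ≤ t → ∀ o', σ t = some (k, o') → rank (loc σ (t + 1) k) < rank (loc σ t k)) :
    ¬ (helpingSnapshot f m V).Blocked σ k o s := by
  rintro ⟨-, hinf, -⟩
  have hle : ∀ t t', N ≤ t → t ≤ t' → rank (loc σ t' k) ≤ rank (loc σ t k) := by
    intro t t' hN htt'
    induction t', htt' using Nat.le_induction with
    | base => exact le_rfl
    | succ t' h1 ih =>
      by_cases hk : ∃ o', σ t' = some (k, o')
      · obtain ⟨o', ho'⟩ := hk
        exact (h t' (by omega) o' ho').le.trans ih
      · push Not at hk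
        rwa [show loc σ (t' + 1) k = loc σ t' k from Implementation.loc_succ_of_ne hk]
  have key : ∀ n t, N ≤ t → rank (loc σ t k) = n → False := by
    intro n
    induction n using Nat.strong_induction_on with
    | _ n ih =>
      intro t hN hn
      obtain ⟨t', ⟨o', ho'⟩, hlt⟩ := hinf.exists_gt t
      have h1 := h t' (by omega) o' ho'
      have h2 := hle t t' hN hlt.le
      exact ih _ (by omega) (t' + 1) (by omega) rfl
  exact key _ N le_rfl rfl

theorem exists_loc_of_blocked {s : ℕ} {o : Op m V} (h : (helpingSnapshot f m V).Blocked σ k o s)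
    (hst : s < t) : ∃ l, loc σ t k = some l ∧ opStart σ t k = s := by
  obtain ⟨h1, h2⟩ := (h.inInterval hst.le).opStart_eq hst
  obtain ⟨l, hl⟩ := Option.ne_none_iff_exists'.1 h1
  exact ⟨l, hl, h2⟩

theorem loc_succ_ne_none_of_blocked {s : ℕ} {o : Op m V}
    (h : (helpingSnapshot f m V).Blocked σ k o s) (hst : s ≤ t) : loc σ (t + 1) k ≠ none := by
  obtain ⟨l, hl, -⟩ := exists_loc_of_blocked h (Nat.lt_succ_of_le hst)
  simp [hl]

theorem blockUpdateWaitFree : (helpingSnapshot f m V).BlockUpdateWaitFree := by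
  intro σ k a s hB
  refine not_blocked_of_rank (N := s + 1) (fun l => match l with
    | some (.append _ _) => 4
    | some (.collect _) => 3
    | some (.announceBlock _ _) => 2
    | some (.finish _) => 1
    | _ => 0) ?_ hB
  intro t ht o' ho'
  obtain ⟨l, hl, hs⟩ := exists_loc_of_blocked hB ht
  have hn := loc_succ_ne_none_of_blocked hB (show s ≤ t by omega)
  have hf := stateFacts hl
  cases l with
  | fresh o => exact hf.elim
  | announceScan H =>
    have h1 := hf.1
    rw [hs] at h1
    cases (h1.eq hB.1).2
  | recheck c =>
    have h1 := hf.1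
    rw [hs] at h1
    cases (h1.eq hB.1).2
  | append a H => simp [hl, (step_append ho' hl).2]
  | collect H => simp [hl, (step_collect ho' hl).2]
  | announceBlock H G => simp [hl, (step_announceBlock ho' hl).2]
  | finish H => exact absurd (step_finish ho' hl).2.1 hn

/-- A Scan is only blocked if blocks are appended again and again: otherwise two consecutive scans
of `H` eventually find the same history. -/
theorem infinite_appends_of_blocked {s : ℕ}
    (hB : (helpingSnapshot f m V).Blocked σ k .scan s) :
    {t | ∃ i a, Appends σ t i a}.Infinite := by
  classical
  intro hfin
  obtain ⟨N, hN⟩ := hfin.bddAbove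
  have hconst : ∀ t, N + 1 ≤ t → hist σ t = hist σ (N + 1) := by
    intro t ht
    induction t, ht using Nat.le_induction with
    | base => rfl
    | succ t ht ih =>
      rw [← ih]
      refine hist_succ_of_not_appends fun i a hi => ?_
      have : t ≤ N := hN ⟨i, a, hi⟩
      omega
  refine not_blocked_of_rank (N := max (N + 1) (s + 1)) (fun l => match l with
    | some (.announceScan H) => if historyOf H = hist σ (N + 1) then 2 else 4
    | some (.recheck c) => if c = hist σ (N + 1) then 1 else 3
    | _ => 0) ?_ hB
  intro t ht o' ho'
  have ht' := hconst t (le_of_max_le_left ht)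
  have hst := le_of_max_le_right ht
  obtain ⟨l, hl, hs⟩ := exists_loc_of_blocked hB hst
  have hn := loc_succ_ne_none_of_blocked hB (show s ≤ t by omega)
  have hf := stateFacts hl
  have hblock : ∀ a, ¬ (helpingSnapshot f m V).Begins σ (opStart σ t k) k (.blockUpdate a) := by
    intro a h1
    rw [hs] at h1
    cases (h1.eq hB.1).2
  cases l with
  | fresh o => exact hf.elim
  | announceScan H =>
    simp only [hl, (step_announceScan ho' hl).2]
    split_ifs <;> omega
  | recheck c =>
    by_cases hc : hist σ t = c
    · exact absurd (step_recheck_eq ho' hl hc).2.1 hn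
    · have hH : historyOf (reg σ t) = hist σ (N + 1) := ht'
      have hc' : ¬ c = hist σ (N + 1) := fun h => hc (ht'.trans h.symm)
      simp [hl, (step_recheck_ne ho' hl hc).2, hH, hc']
  | append a H => exact absurd hf.1 (hblock a)
  | collect H => exact absurd hf.1.choose_spec (hblock _)
  | announceBlock H G => exact absurd hf.1.choose_spec (hblock _)
  | finish H => exact absurd hf.1.choose_spec (hblock _)

theorem scanBlockedOnlyByBlockUpdates :
    (helpingSnapshot f m V).ScanBlockedOnlyByBlockUpdates := by
  intro σ k s hB
  obtain ⟨i, hi⟩ : ∃ i, {t | ∃ a, Appends σ t i a}.Infinite := by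
    by_contra hno
    simp only [not_exists, Set.not_infinite] at hno
    refine infinite_appends_of_blocked hB ((Set.finite_iUnion hno).subset ?_)
    rintro t ⟨i, a, h⟩
    exact Set.mem_iUnion.2 ⟨i, a, h⟩
  have hinj : Set.InjOn (fun t => opStart σ t i) {t | ∃ a, Appends σ t i a} := by
    rintro t ⟨a, h⟩ t' ⟨a', h'⟩ heq
    exact h.eq_of_opStart_eq h' heq
  refine (hi.image hinj).mono ?_
  rintro _ ⟨t, ⟨a, h⟩, rfl⟩
  -- the operation is completed because its process appends another block later
  obtain ⟨t', ⟨a', h'⟩, hlt⟩ := hi.exists_gt t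
  obtain ⟨e, r, hc⟩ := Implementation.exists_completes_of_opStart_ne h.2.begins
    (h.2.lt.trans hlt) fun heq => hlt.ne (h.eq_of_opStart_eq h' heq.symm)
  exact ⟨i, a, e, r, hc⟩

theorem nonBlocking : (helpingSnapshot f m V).NonBlocking := by
  intro σ hinf hfin
  obtain ⟨k, hk⟩ : ∃ k, {t | ∃ o, σ t = some (k, o)}.Infinite := by
    by_contra hno
    simp only [not_exists, Set.not_infinite] at hno
    refine hinf ((Set.finite_iUnion hno).subset fun t ht => ?_)
    obtain ⟨⟨k, o⟩, ho⟩ := Option.ne_none_iff_exists'.1 ht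
    exact Set.mem_iUnion.2 ⟨k, o, ho⟩
  obtain ⟨N, hN⟩ := hfin.bddAbove
  obtain ⟨t, ⟨o, ho⟩, hNt⟩ := hk.exists_gt N
  have hno : ∀ e, t ≤ e → ∀ r, ¬ (helpingSnapshot f m V).Responds σ e k r := by
    intro e he r hr
    have : e ≤ N := hN ⟨k, r, hr⟩
    omega
  -- the operation that `k` carries out at time `t` is blocked
  obtain ⟨s, o, hB⟩ : ∃ s o, (helpingSnapshot f m V).Blocked σ k o s := by
    by_cases hl : loc σ t k = none
    · exact ⟨t, o, ⟨ho, hl⟩, hk, fun e r hc => hno e hc.2.1 r hc.2.2.1⟩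
    · obtain ⟨h1, ⟨o', h2⟩, h3⟩ :=
        Implementation.exists_begins_opStart (I := helpingSnapshot f m V) hl
      refine ⟨_, o', h2, hk, fun e r hc => ?_⟩
      rcases lt_or_ge e t with he | he
      · exact h3 e hc.2.1 he r hc.2.2.1
      · exact hno e he r hc.2.2.1
  cases o with
  | blockUpdate a => exact blockUpdateWaitFree σ k a s hB
  | scan =>
    refine scanBlockedOnlyByBlockUpdates σ k s hB
      ((Set.finite_iUnion fun j => hfin.image fun e => opStart σ e j).subset ?_)
    rintro s' ⟨j, a, e, r, hc⟩
    exact Set.mem_iUnion.2 ⟨j, e, ⟨j, r, hc.2.2.1⟩, (state_of_completes hc).1⟩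

/-! ### Yielding -/

/-- The step that appends the block is the first update of `H` in a Block-Update. -/
theorem Appends.firstUpdateIn (h : Appends σ t k a) :
    (helpingSnapshot f m V).FirstUpdateIn σ k (.blockUpdate a) (opStart σ t k) t := by
  refine ⟨⟨h.2.inInterval, ?_⟩, ?_⟩
  · obtain ⟨⟨o, ho⟩, H, hl⟩ := h
    refine ⟨o, ⟨(H k).blocks ++ [⟨a, (historyOf H).nextStamp k⟩], (H k).log⟩, .inl (.collect H),
      ho, ?_⟩
    rw [action_eq, hl]
    rfl
  · rintro t' ⟨hin, o', x, c, ho', hact⟩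
    by_contra hlt
    have hb := hin.1
    rcases hin.2.1.lt_or_eq with hst | hst
    · have h1 := length_hist_mono (σ := σ) k hst.le
      have h2 := length_hist_mono (σ := σ) k (not_le.1 hlt).le
      rw [h.2.hist_eq] at h2
      have hp : Pending σ t' k a := pending_of_inInterval hin hst (by omega)
      exact hlt ((h.eq_of_opStart_eq ⟨⟨o', ho'⟩, hp⟩ (hin.opStart_eq hst).2.symm).le)
    · rw [hst] at hb
      have hl : loc σ t' k = none := hb.2
      have ho := hb.1
      rw [ho'] at ho
      cases ho
      rw [action_eq, hl] at hact
      cases hact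

theorem yieldsOnlyToLower : (helpingSnapshot f m V).YieldsOnlyToLower := by
  intro σ k a s e hc
  have := (completes_block hc).2
  split_ifs at this with h
  obtain ⟨i, hik, hlt⟩ := h
  obtain ⟨x, b, h1, h2, h3⟩ := exists_appends_of_length_lt hc.2.1 hlt
  exact ⟨i, hik, b, _, x, h3.firstUpdateIn, h1, h2.le⟩

end HelpingSnapshot
end AugSnapshot

theorem theorem1 (f m : ℕ) (V : Type u) :
    ∃ I : AugSnapshot.Implementation f m V,
      I.IsAugmentedSnapshot ∧ I.NonBlocking ∧ I.BlockUpdateWaitFree ∧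
      I.ScanBlockedOnlyByBlockUpdates ∧ I.YieldsOnlyToLower :=
  ⟨AugSnapshot.helpingSnapshot f m V, AugSnapshot.HelpingSnapshot.isAugmentedSnapshot,
    AugSnapshot.HelpingSnapshot.nonBlocking, AugSnapshot.HelpingSnapshot.blockUpdateWaitFree,
    AugSnapshot.HelpingSnapshot.scanBlockedOnlyByBlockUpdates,
    AugSnapshot.HelpingSnapshot.yieldsOnlyToLower⟩
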